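/- Let $n\ge 1$ and let $J$ be the jet space with coordinates $(x,(u_K)_K)$, where $x=(x^1,\dots,x^n)$ are the independent variables, $u$ is a single dependent variable and $K$ runs over all multi-indices. Let $\mathcal U\subseteq J$ be an open domain defined by an open condition on finitely many coordinates (for instance $\mathcal U=J$). A differential function is a smooth function on $\mathcal U$ of $x$ and finitely many $u_K$. A linear differential operator in total derivatives is a finite sum $R=\sum_K R^K D_K$ with differential functions $R^K$ as coefficients, and $R^*$ denotes its formal adjoint, $R^*(f)=\sum_K(-1)^{|K|}D_K(R^Kf)$, again written in the form $\sum_K (R^*)^K D_K$. For a differential function $f$, let $f'=\sum_K \frac{\partial f}{\partial u_K}D_K$ be its Frechet derivative, $E_u(f)=\sum_K(-1)^{|K|}D_K\frac{\partial f}{\partial u_K}$ its variational derivative, and, for $\hat{\mathrm X}_P=P\partial_u$, let $\mathrm{pr}\,\hat{\mathrm X}_P(f)=f'(P)$ and $\mathrm{pr}\,\hat{\mathrm X}_P R=\sum_K \big((R^K)'(P)\big)D_K$. Let $G$ be a differential function, and let $\mathcal E\subseteq\mathcal U$ be the set of jets of formal solutions of $G=0$, that is, the set of common zeros of all $D_KG$.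 Let $P$ and $Q$ be differential functions such that $\hat{\mathrm X}_P$ is a symmetry of $G=0$ and $Q$ is an adjoint-symmetry of $G=0$, namely $G'(P)|_{\mathcal E}=0$ and $G'^*(Q)|_{\mathcal E}=0$, and let $R_P,R_Q$ be linear differential operators in total derivatives such that $$G'(P)=R_P(G),\qquad G'^*(Q)=R_Q(G)$$ hold identically on $\mathcal U$. Put $S:=R_Q^*+Q'$. Then $S(P)$ is an adjoint-symmetry of $G=0$, and it is a multiplier of a conservation law of $G=0$ if and only if $$\big(\mathrm{pr}\,\hat{\mathrm X}_P S^*+S^*R_P+P'^*S^*\big)G=0 \quad\text{identically on } \mathcal U .$$ Here $S(P)$ is called a multiplier of a conservation law if every point of $\mathcal U$ has a neighbourhood, again a domain of the above kind, on which $S(P)\,G=\sum_i D_{x^i}\Phi^i$ for some differential functions $\Phi^1,\dots,\Phi^n$. The same equivalence holds with the determining equation "$E_u(S(P)G)=0$ identically on $\mathcal U$" in place of the multiplier property, and, if $\mathcal U=J$, also with the existence of differential functions $\Phi^i$ on all of $J$ such that $S(P)\,G=\sum_i D_{x^i}\Phi^i$. -/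

import Mathlib

noncomputable section

namespace JetCalculus

/-- A multi-index `J`: the entry `J i` is the multiplicity of the differentiation index `i`. -/
abbrev MultiIndex (n : ℕ) : Type := Fin n → ℕ

/-- The order `|J|` of a multi-index. -/
def MultiIndex.order {n : ℕ} (J : MultiIndex n) : ℕ := ∑ i, J i

/-- The multi-index binomial coefficient `J! / (K! (J - K)!)` for `K ≤ J`. -/
def MultiIndex.binom {n : ℕ} (J K : MultiIndex n) : ℕ := ∏ i, (J i).choose (K i)

/-- The jet space with coordinates `(x, (u_J)_J)`: `n` independent variables and all the
derivatives `u_J` of one dependent variable (`u = u_0`). -/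
abbrev Jet (n : ℕ) : Type := (Fin n → ℝ) × (MultiIndex n → ℝ)

/-- The jet space that only records `x` and the finitely many coordinates `u_J`, `J ∈ s`. -/
abbrev FinJet (n : ℕ) (s : Finset (MultiIndex n)) : Type := (Fin n → ℝ) × (s → ℝ)

/-- The projection that forgets the coordinates `u_J` with `J ∉ s`. -/
def proj {n : ℕ} (s : Finset (MultiIndex n)) (p : Jet n) : FinJet n s :=
  (p.1, fun J => p.2 J)

/-- An open domain in jet space, cut out by an open condition on finitely many jet coordinates. -/
def IsJetDomain {n : ℕ} (U : Set (Jet n)) : Prop :=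
  ∃ (s : Finset (MultiIndex n)) (V : Set (FinJet n s)), IsOpen V ∧ U = proj s ⁻¹' V

/-- `f` is a differential function on `U`: a smooth function of `x` and finitely many of the
`u_J`, that is, of `(x, u^{(k)})` for some finite order `k`.
(Values of `f` outside `U` carry no information.) -/
def IsDiffFun {n : ℕ} (U : Set (Jet n)) (f : Jet n → ℝ) : Prop :=
  ∃ (s : Finset (MultiIndex n)) (g : FinJet n s → ℝ),
    ContDiffOn ℝ (⊤ : ℕ∞) g (proj s '' U) ∧ ∀ p ∈ U, f p = g (proj s p)

/-- The partial derivative with respect to the coordinate `x^i`. -/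
def partialX {n : ℕ} (i : Fin n) (f : Jet n → ℝ) : Jet n → ℝ := fun p =>
  deriv (fun t : ℝ => f (Function.update p.1 i t, p.2)) (p.1 i)

/-- The partial derivative with respect to the coordinate `u_K`. -/
def partialU {n : ℕ} (K : MultiIndex n) (f : Jet n → ℝ) : Jet n → ℝ := fun p =>
  deriv (fun t : ℝ => f (p.1, Function.update p.2 K t)) (p.2 K)

/-- The total derivative `D_i = ∂_{x^i} + ∑_K u_{i,K} ∂_{u_K}`. For a differential function only
finitely many terms of the sum are non-zero. -/
def totalDeriv {n : ℕ} (i : Fin n) (f : Jet n → ℝ) : Jet n → ℝ := fun p =>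
  partialX i f p + ∑ᶠ K : MultiIndex n, p.2 (K + Pi.single i 1) * partialU K f p

/-- The iterated total derivative `D_J = D_1^{J_1} ⋯ D_n^{J_n}`. -/
def totalDerivs {n : ℕ} (J : MultiIndex n) (f : Jet n → ℝ) : Jet n → ℝ :=
  (List.finRange n).foldr (fun i g => (totalDeriv i)^[J i] g) f

/-- A linear operator `∑_J R^J D_J` in total derivatives, given by its coefficients `R^J`. -/
abbrev DiffOp (n : ℕ) : Type := MultiIndex n → Jet n → ℝ

/-- `R = ∑_J R^J D_J` is a linear differential operator on `U`: its coefficients are differential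
functions on `U`, and only finitely many of them are non-zero on `U`. -/
def IsDiffOp {n : ℕ} (U : Set (Jet n)) (R : DiffOp n) : Prop :=
  (∀ J, IsDiffFun U (R J)) ∧ ∃ s : Finset (MultiIndex n), ∀ J ∉ s, ∀ p ∈ U, R J p = 0

namespace DiffOp

/-- The action `R(f) = ∑_J R^J D_J f`. -/
def apply {n : ℕ} (R : DiffOp n) (f : Jet n → ℝ) : Jet n → ℝ := fun p =>
  ∑ᶠ J : MultiIndex n, R J p * totalDerivs J f p

/-- The formal adjoint `R^*(f) = ∑_J (-1)^{|J|} D_J(R^J f)`, expanded by the Leibniz rule into the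
form `∑_K (R^*)^K D_K`; here
`(R^*)^K = ∑_{J ≥ K} (-1)^{|J|} binom(J, K) D_{J - K} R^J`, with `J = K + L` below. -/
def adjoint {n : ℕ} (R : DiffOp n) : DiffOp n := fun K p =>
  ∑ᶠ L : MultiIndex n,
    (-1 : ℝ) ^ (K + L).order * ((K + L).binom K : ℝ) * totalDerivs L (R (K + L)) p

end DiffOp

/-- The Frechet derivative `f' = ∑_K (∂f/∂u_K) D_K`, as an operator. -/
def frechet {n : ℕ} (f : Jet n → ℝ) : DiffOp n := fun K => partialU K f

/-- The action `pr X_P (f) = ∑_K (D_K P) ∂f/∂u_K = f'(P)` of the prolongation of the vector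
field `X_P = P ∂_u` on differential functions. -/
def prolong {n : ℕ} (P f : Jet n → ℝ) : Jet n → ℝ := (frechet f).apply P

/-- The action `pr X_P R = ∑_J (pr X_P R^J) D_J` of the prolongation of `X_P = P ∂_u` on
operators `R = ∑_J R^J D_J`. -/
def prolongOp {n : ℕ} (P : Jet n → ℝ) (R : DiffOp n) : DiffOp n := fun J => prolong P (R J)

/-- The Euler--Lagrange operator `E_u(f) = ∑_K (-1)^{|K|} D_K(∂f/∂u_K)`. -/
def eulerLagrange {n : ℕ} (f : Jet n → ℝ) : Jet n → ℝ := fun p =>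
  ∑ᶠ K : MultiIndex n, (-1 : ℝ) ^ K.order * totalDerivs K (partialU K f) p

/-- The jets (in `U`) of formal solutions of `G = 0`: a formal power series solves `G = 0` iff its
jet is a zero of `G` and of all the differential consequences `D_J G`. -/
def solutionSpace {n : ℕ} (U : Set (Jet n)) (G : Jet n → ℝ) : Set (Jet n) :=
  {p | p ∈ U ∧ ∀ J : MultiIndex n, totalDerivs J G p = 0}

/-- `P ∂_u` is a symmetry of `G = 0`: `pr X_P (G) = G'(P) = 0` on the solution space. -/
def IsSymmetry {n : ℕ} (U : Set (Jet n)) (G P : Jet n → ℝ) : Prop :=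
  IsDiffFun U P ∧ ∀ p ∈ solutionSpace U G, prolong P G p = 0

/-- `Q` is an adjoint-symmetry of `G = 0`: `G'^*(Q) = 0` on the solution space. -/
def IsAdjointSymmetry {n : ℕ} (U : Set (Jet n)) (G Q : Jet n → ℝ) : Prop :=
  IsDiffFun U Q ∧ ∀ p ∈ solutionSpace U G, (frechet G).adjoint.apply Q p = 0

/-- `f = D_i Φ^i` on `U` for differential functions `Φ^i` on `U`. -/
def IsTotalDivergence {n : ℕ} (U : Set (Jet n)) (f : Jet n → ℝ) : Prop :=
  ∃ Φ : Fin n → Jet n → ℝ,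
    (∀ i, IsDiffFun U (Φ i)) ∧ ∀ p ∈ U, ∑ i, totalDeriv i (Φ i) p = f p

/-- `Q` is a multiplier of a conservation law of `G = 0` on `U`: `D_i Φ^i = Q G` holds off of the
solution space. As the domain `U` may have non-trivial topology, the conserved current `Φ` is only
required to exist near each point of `U`. -/
def IsMultiplier {n : ℕ} (U : Set (Jet n)) (G Q : Jet n → ℝ) : Prop :=
  IsDiffFun U Q ∧ ∀ p ∈ U, ∃ V : Set (Jet n), IsJetDomain V ∧ p ∈ V ∧ V ⊆ U ∧
    IsTotalDivergence V (fun q => Q q * G q)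

/-- The operator `S = R_Q^* + Q'`. -/
def opS {n : ℕ} (Q : Jet n → ℝ) (RQ : DiffOp n) : DiffOp n := RQ.adjoint + frechet Q

/-- The equation `(pr X_P S^* + S^* R_P + P'^* S^*) G = 0`, off of the solution space, that is,
identically on `U`. -/
def MultiplierCondition {n : ℕ} (U : Set (Jet n)) (G P : Jet n → ℝ) (S RP : DiffOp n) : Prop :=
  ∀ p ∈ U, (prolongOp P S.adjoint).apply G p + S.adjoint.apply (RP.apply G) p
    + (frechet P).adjoint.apply (S.adjoint.apply G) p = 0

end JetCalculus

end

noncomputable section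

namespace JetCalculus

open Finsupp

/-! The left side of the condition is identically equal to `E_u(S(P) G)`; everything else follows
from this identity. By the definition of `S` and the identity for `Q`, `S^*(G) = R_Q(G) + Q'^*(G) =
G'^*(Q) + Q'^*(G) = E_u(Q G)`. Modulo total divergences, Green's identity gives `S(P) G ≡ P S^*(G) =
P E_u(Q G) ≡ pr X_P(Q G)`. Since `E_u` kills divergences, `E_u(S(P) G) = E_u(pr X_P(Q G)) = pr
X_P(E_u(Q G)) + P'^*(E_u(Q G))`, the last step being the commutation rule `euler_pr`. Putting back
`E_u(Q G) = S^*(G)` and expanding `pr X_P(S^* G) = (pr X_P S^*) G + S^*(G'(P))` with `G'(P) =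
R_P(G)` yields the condition (`euler_app_mul`).

The product rule `E_u(S(P) G) = G'^*(S(P)) + S(P)'^*(G)` then exhibits `G'^*(S(P))` as a combination
of the `D_K G`, so it vanishes on the solution jets.

Multipliers satisfy `E_u(S(P) G) = 0` because `E_u` annihilates divergences. The converse is local
exactness at `E_u`. A domain need not contain the zero section, so a function with `E_u f = 0` is
contracted along the fibres to the jets of a polynomial through the given point. The derivative
along this homotopy is a divergence, again by Green's identity, and integrating over the parameter
leaves a function of `x` alone. That remainder is a divergence by integration in a single variable
`x^i`, which is where `n ≥ 1` enters.

The algebra is done in an abstract ring with derivations `D_i` and `∂_{u_K}`. Differential functions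
on `U`, identified when equal on `U`, form such a ring (`jetAlg`), and `Represents` translates
between the two settings. -/

/-- A family of commuting derivations of an algebra, to be thought of as total derivatives. -/
structure CommDerivations (n : ℕ) (A : Type*) [CommRing A] [Algebra ℝ A] where
  /-- The derivations. -/
  D : Fin n → Derivation ℝ A A
  comm : ∀ i j a, D i (D j a) = D j (D i a)

/-! ### Multi-indices and binomial coefficients -/

namespace MultiIndex

variable {n : ℕ}

theorem induction_add_single {p : MultiIndex n → Prop} (zero : p 0)
    (add : ∀ K i, p K → p (K + Pi.single i 1)) (K : MultiIndex n) : p K := by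
  induction h : K.order generalizing K with
  | zero =>
    have : K = 0 := by
      ext i
      simpa using (Finset.sum_eq_zero_iff.1 h) i (Finset.mem_univ i)
    exact this ▸ zero
  | succ m ih =>
    obtain ⟨i, hi⟩ : ∃ i, K i ≠ 0 := by
      by_contra! hK
      simp [order, hK] at h
    have hK : K = (K - Pi.single i 1) + Pi.single i 1 := by
      ext j
      by_cases hj : j = i
      · subst hj; simp; omega
      · simp [hj]
    have h' : (K - Pi.single i 1).order + 1 = K.order := by
      conv_rhs => rw [hK]
      simp [order, Finset.sum_add_distrib]
    rw [hK]
    exact add _ _ (ih _ (by omega))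

@[simp] theorem order_zero : order (0 : MultiIndex n) = 0 := by simp [order]

@[simp] theorem order_add_single (K : MultiIndex n) (i : Fin n) :
    order (K + Pi.single i 1) = K.order + 1 := by
  simp [order, Finset.sum_add_distrib]

theorem binom_eq_zero {J K : MultiIndex n} (h : ¬ K ≤ J) : binom J K = 0 := by
  obtain ⟨i, hi⟩ : ∃ i, J i < K i := by simpa [Pi.le_def] using h
  exact Finset.prod_eq_zero (Finset.mem_univ i) (Nat.choose_eq_zero_of_lt hi)

theorem binom_add_single (J K : MultiIndex n) (i : Fin n) :
    binom (J + Pi.single i 1) (K + Pi.single i 1) = binom J K + binom J (K + Pi.single i 1) := by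
  simp only [binom]
  have hp : ∀ f : Fin n → ℕ, ∏ j, f j = f i * ∏ j ∈ Finset.univ.erase i, f j :=
    fun f => (Finset.mul_prod_erase _ _ (Finset.mem_univ i)).symm
  rw [hp, hp, hp]
  have h1 : ∀ j ∈ Finset.univ.erase i, ((J + Pi.single i 1 : MultiIndex n) j).choose
      ((K + Pi.single i 1 : MultiIndex n) j) = (J j).choose (K j) := by
    intro j hj
    simp [Finset.ne_of_mem_erase hj]
  have h2 : ∀ j ∈ Finset.univ.erase i, (J j).choose
      ((K + Pi.single i 1 : MultiIndex n) j) = (J j).choose (K j) := by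
    intro j hj
    simp [Finset.ne_of_mem_erase hj]
  rw [Finset.prod_congr rfl h1, Finset.prod_congr rfl h2]
  simp [Nat.choose_succ_succ, add_mul]

theorem binom_add_single_of_eq_zero (J : MultiIndex n) {K : MultiIndex n} {i : Fin n}
    (h : K i = 0) : binom (J + Pi.single i 1) K = binom J K := by
  refine Finset.prod_congr rfl fun j _ => ?_
  by_cases hj : j = i
  · subst hj; simp [h]
  · simp [hj]

theorem exists_eq_add_single {K : MultiIndex n} {i : Fin n} (h : K i ≠ 0) :
    ∃ L : MultiIndex n, K = L + Pi.single i 1 := by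
  refine ⟨K - Pi.single i 1, ?_⟩
  ext j
  by_cases hj : j = i
  · subst hj; simp; omega
  · simp [hj]

end MultiIndex

/-! ### Operators in commuting derivations: Green's identity and adjoints -/

namespace CommDerivations

variable {n : ℕ} {A : Type*} [CommRing A] [Algebra ℝ A] (𝒟 : CommDerivations n A)

/-- The iterated derivation `D_J = D_1^{J_1} ⋯ D_n^{J_n}`. -/
def iter (J : MultiIndex n) : Module.End ℝ A :=
  ((List.finRange n).map fun i => ((𝒟.D i : A →ₗ[ℝ] A) : Module.End ℝ A) ^ J i).prod

theorem iter_apply_eq_foldr (J : MultiIndex n) (a : A) :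
    𝒟.iter J a = (List.finRange n).foldr (fun i g => (𝒟.D i)^[J i] g) a := by
  unfold iter
  induction List.finRange n with
  | nil => simp
  | cons i l ih =>
    rw [List.map_cons, List.prod_cons, Module.End.mul_apply, ih, List.foldr_cons,
      Module.End.pow_apply]
    rfl

@[simp] theorem iter_zero (a : A) : 𝒟.iter 0 a = a := by
  rw [iter_apply_eq_foldr]
  induction List.finRange n with
  | nil => rfl
  | cons i l ih => simp

/-- The ordered product `D_1^{J_1} ⋯ D_n^{J_n}` gains one factor `D_i` in its `i`-th slot;
commutativity moves that factor to the front. -/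
theorem iter_add_single (J : MultiIndex n) (i : Fin n) (a : A) :
    𝒟.iter (J + Pi.single i 1) a = 𝒟.D i (𝒟.iter J a) := by
  have hc : ∀ j k, Commute ((𝒟.D j : A →ₗ[ℝ] A) : Module.End ℝ A) (𝒟.D k : A →ₗ[ℝ] A) :=
    fun j k => LinearMap.ext fun b => 𝒟.comm j k b
  -- Stated for arbitrary duplicate-free lists of directions to allow induction; the slot `i` then
  -- occurs at most once.
  have key : ∀ l : List (Fin n), l.Nodup →
      (l.map fun j => ((𝒟.D j : A →ₗ[ℝ] A) : Module.End ℝ A) ^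
        (J + Pi.single i 1 : MultiIndex n) j).prod =
      if i ∈ l then ((𝒟.D i : A →ₗ[ℝ] A) : Module.End ℝ A) *
          (l.map fun j => ((𝒟.D j : A →ₗ[ℝ] A) : Module.End ℝ A) ^ J j).prod
        else (l.map fun j => ((𝒟.D j : A →ₗ[ℝ] A) : Module.End ℝ A) ^ J j).prod := by
    intro l
    induction l with
    | nil => simp
    | cons j l ih =>
      intro hl
      rw [List.nodup_cons] at hl
      simp only [List.map_cons, List.prod_cons]
      rw [ih hl.2]
      by_cases hij : i = j
      · subst hij
        simp [hl.1, pow_succ', mul_assoc]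
      · by_cases hil : i ∈ l
        · simp only [hil, List.mem_cons, or_true, if_true, Pi.add_apply,
            Pi.single_eq_of_ne (Ne.symm hij), add_zero]
          rw [← mul_assoc, ← mul_assoc, ((hc j i).pow_left (J j)).eq]
        · simp [hil, hij, Ne.symm hij]
  have := key _ (List.nodup_finRange n)
  simp only [List.mem_finRange, if_true] at this
  exact congrArg (fun T : Module.End ℝ A => T a) this

theorem iter_D (J : MultiIndex n) (i : Fin n) (a : A) :
    𝒟.iter J (𝒟.D i a) = 𝒟.D i (𝒟.iter J a) := by
  induction J using MultiIndex.induction_add_single with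
  | zero => simp
  | add K j ih => rw [iter_add_single, iter_add_single, ih, 𝒟.comm]

/-- The signed iterated derivation `(-D)_J = (-1)^{|J|} D_J`. -/
def negIter (J : MultiIndex n) : Module.End ℝ A := (-1 : ℝ) ^ J.order • 𝒟.iter J

theorem negIter_apply (J : MultiIndex n) (a : A) :
    𝒟.negIter J a = (-1 : ℝ) ^ J.order • 𝒟.iter J a := rfl

@[simp] theorem negIter_zero (a : A) : 𝒟.negIter 0 a = a := by simp [negIter_apply]

theorem negIter_add_single (J : MultiIndex n) (i : Fin n) (a : A) :
    𝒟.negIter (J + Pi.single i 1) a = - 𝒟.negIter J (𝒟.D i a) := by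
  simp [negIter_apply, iter_add_single, iter_D, pow_succ]

/-- The space of total divergences. -/
def divergences : Submodule ℝ A := ⨆ i, LinearMap.range (𝒟.D i : A →ₗ[ℝ] A)

theorem D_mem_divergences (i : Fin n) (a : A) : 𝒟.D i a ∈ 𝒟.divergences :=
  Submodule.mem_iSup_of_mem i ⟨a, rfl⟩

theorem mem_divergences_iff (a : A) :
    a ∈ 𝒟.divergences ↔ ∃ Φ : Fin n → A, ∑ i, 𝒟.D i (Φ i) = a := by
  constructor
  · intro h
    refine Submodule.iSup_induction _
      (motive := fun a => ∃ Φ : Fin n → A, ∑ i, 𝒟.D i (Φ i) = a) h ?_ ?_ ?_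
    · rintro i _ ⟨b, rfl⟩
      refine ⟨Pi.single i b, ?_⟩
      rw [Finset.sum_eq_single i]
      · simp
      · intro j _ hj; simp [hj]
      · simp
    · exact ⟨0, by simp⟩
    · rintro _ _ ⟨Φ, rfl⟩ ⟨Ψ, rfl⟩
      exact ⟨Φ + Ψ, by simp [Finset.sum_add_distrib]⟩
  · rintro ⟨Φ, rfl⟩
    exact Submodule.sum_mem _ fun i _ => 𝒟.D_mem_divergences i _

/-- Integration by parts, one derivative at a time: `a D_i D_K b = D_i(a D_K b) - (D_i a) D_K b`.
The factor `a` changes to `D_i a`, hence the induction for all `a`. -/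
theorem mul_iter_sub_negIter_mul_mem_divergences (K : MultiIndex n) (a b : A) :
    a * 𝒟.iter K b - 𝒟.negIter K a * b ∈ 𝒟.divergences := by
  induction K using MultiIndex.induction_add_single generalizing a with
  | zero => simp
  | add K i ih =>
    have h := Submodule.add_mem _ (𝒟.D_mem_divergences i (a * 𝒟.iter K b))
      (Submodule.neg_mem _ (ih (𝒟.D i a)))
    convert h using 1
    rw [iter_add_single, negIter_add_single, Derivation.leibniz]
    simp only [smul_eq_mul]
    ring

/-- The action `∑_K T^K D_K a` of a linear operator in total derivatives. -/
def app (T : MultiIndex n →₀ A) (a : A) : A := T.sum fun K t => t * 𝒟.iter K a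

/-- The action `∑_K (-D)_K (T^K a)` of the formal adjoint of `∑_K T^K D_K`. -/
def dag (T : MultiIndex n →₀ A) (a : A) : A := T.sum fun K t => 𝒟.negIter K (t * a)

variable (S T : MultiIndex n →₀ A)

theorem app_add (a : A) : 𝒟.app (S + T) a = 𝒟.app S a + 𝒟.app T a :=
  sum_add_index' (by simp) (by intros; ring)

theorem dag_add (a : A) : 𝒟.dag (S + T) a = 𝒟.dag S a + 𝒟.dag T a :=
  sum_add_index' (by simp) (by intros; rw [add_mul, map_add])

@[simp] theorem app_zero (a : A) : 𝒟.app 0 a = 0 := by simp [app]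

@[simp] theorem dag_zero (a : A) : 𝒟.dag 0 a = 0 := by simp [dag]

@[simp] theorem app_single (K : MultiIndex n) (t a : A) :
    𝒟.app (single K t) a = t * 𝒟.iter K a := sum_single_index (by simp)

@[simp] theorem dag_single (K : MultiIndex n) (t a : A) :
    𝒟.dag (single K t) a = 𝒟.negIter K (t * a) := sum_single_index (by simp)

theorem app_finset_sum {ι : Type*} (s : Finset ι) (F : ι → MultiIndex n →₀ A) (a : A) :
    𝒟.app (∑ i ∈ s, F i) a = ∑ i ∈ s, 𝒟.app (F i) a :=
  map_sum (AddMonoidHom.mk' (fun T => 𝒟.app T a) fun S T => 𝒟.app_add S T a) F s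

theorem dag_finset_sum {ι : Type*} (s : Finset ι) (F : ι → MultiIndex n →₀ A) (a : A) :
    𝒟.dag (∑ i ∈ s, F i) a = ∑ i ∈ s, 𝒟.dag (F i) a :=
  map_sum (AddMonoidHom.mk' (fun T => 𝒟.dag T a) fun S T => 𝒟.dag_add S T a) F s

theorem app_smul (c : ℝ) (a : A) : 𝒟.app (c • T) a = c • 𝒟.app T a := by
  simp only [app]
  rw [sum_smul_index' (by simp), smul_sum]
  simp

theorem dag_smul (c : ℝ) (a : A) : 𝒟.dag (c • T) a = c • 𝒟.dag T a := by
  simp only [dag]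
  rw [sum_smul_index' (by simp), smul_sum]
  simp

theorem dag_smul_left (f a : A) : 𝒟.dag (f • T) a = 𝒟.dag T (f * a) := by
  simp only [dag]
  rw [sum_smul_index' (by simp)]
  simp only [smul_eq_mul]
  exact Finsupp.sum_congr fun K _ => by ring_nf

theorem app_smul_left (f a : A) : 𝒟.app (f • T) a = f * 𝒟.app T a := by
  simp only [app]
  rw [sum_smul_index' (by simp), Finsupp.mul_sum]
  simp only [smul_eq_mul]
  exact Finsupp.sum_congr fun K _ => by ring

/-- Green's identity. -/
theorem app_mul_sub_mul_dag_mem_divergences (a b : A) :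
    𝒟.app T a * b - a * 𝒟.dag T b ∈ 𝒟.divergences := by
  induction T using Finsupp.induction_linear with
  | zero => simp
  | add S T hS hT =>
    rw [app_add, dag_add]
    convert Submodule.add_mem _ hS hT using 1
    ring
  | single K t =>
    rw [app_single, dag_single]
    convert 𝒟.mul_iter_sub_negIter_mul_mem_divergences K (t * b) a using 1
    ring

/-- The operator `D_i ∘ ∑_K T^K D_K`. -/
def dcomp (i : Fin n) (T : MultiIndex n →₀ A) : MultiIndex n →₀ A :=
  T.mapRange (𝒟.D i) (map_zero _) + T.mapDomain (· + Pi.single i 1)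

theorem app_dcomp (i : Fin n) (a : A) : 𝒟.app (𝒟.dcomp i T) a = 𝒟.D i (𝒟.app T a) := by
  simp only [dcomp, app_add]
  simp only [app]
  rw [sum_mapRange_index (by simp), sum_mapDomain_index (by simp) (by intros; ring),
    Finsupp.sum, Finsupp.sum, Finsupp.sum, map_sum, ← Finset.sum_add_distrib]
  refine Finset.sum_congr rfl fun K _ => ?_
  rw [iter_add_single, Derivation.leibniz]
  simp only [smul_eq_mul]
  ring

/-- Reversal of order under adjoints, `(D_i ∘ T)^* = -T^* ∘ D_i`: in the sum of the two parts of
`dcomp`, the terms containing `D_i T^K` cancel. -/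
theorem dag_dcomp (i : Fin n) (a : A) : 𝒟.dag (𝒟.dcomp i T) a = - 𝒟.dag T (𝒟.D i a) := by
  simp only [dcomp, dag_add]
  simp only [dag]
  rw [sum_mapRange_index (by simp), sum_mapDomain_index (by simp)
    (by intros; rw [add_mul, map_add]),
    Finsupp.sum, Finsupp.sum, Finsupp.sum, ← Finset.sum_neg_distrib, ← Finset.sum_add_distrib]
  refine Finset.sum_congr rfl fun K _ => ?_
  rw [negIter_add_single, Derivation.leibniz, ← sub_eq_add_neg, ← map_sub, ← map_neg]
  congr 1
  simp only [smul_eq_mul]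
  ring

theorem mapDomain_add_single_apply {n : ℕ} {A : Type*} [CommRing A]
    (T : MultiIndex n →₀ A) (i : Fin n) (K : MultiIndex n) :
    T.mapDomain (· + Pi.single i 1) (K + Pi.single i 1) = T K :=
  Finsupp.mapDomain_apply (add_left_injective _) T K

theorem mapDomain_add_single_apply_of_eq_zero {n : ℕ} {A : Type*} [CommRing A]
    (T : MultiIndex n →₀ A) {i : Fin n} {K : MultiIndex n} (h : K i = 0) :
    T.mapDomain (· + Pi.single i 1) K = 0 := by
  refine Finsupp.mapDomain_of_notMem_range T K ?_
  rintro ⟨L, rfl⟩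
  simp at h

/-- The operator `D_J ∘ a`, expanded by the Leibniz rule. -/
def leib (J : MultiIndex n) (a : A) : MultiIndex n →₀ A :=
  Finsupp.onFinset (Finset.Iic J) (fun K => (J.binom K : ℝ) • 𝒟.iter (J - K) a) fun K h => by
    by_contra hK
    rw [MultiIndex.binom_eq_zero (by simpa using hK)] at h
    simp at h

theorem leib_apply (J : MultiIndex n) (a : A) (K : MultiIndex n) :
    𝒟.leib J a K = (J.binom K : ℝ) • 𝒟.iter (J - K) a := rfl

theorem leib_zero (a : A) : 𝒟.leib 0 a = single 0 a := by
  ext K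
  rw [leib_apply]
  by_cases hK : K = 0
  · subst hK; simp [MultiIndex.binom]
  · rw [MultiIndex.binom_eq_zero (by simpa using hK)]
    simp [Ne.symm hK]

/-- Pascal's rule in the `i`-th entry. This recursion replaces explicit binomial sums: `app_leib`
and `dag_leib` follow from it by adding one derivative at a time. -/
theorem leib_add_single (J : MultiIndex n) (i : Fin n) (a : A) :
    𝒟.leib (J + Pi.single i 1) a = 𝒟.dcomp i (𝒟.leib J a) := by
  have sub_eq : ∀ K : MultiIndex n, K ≤ J → J + Pi.single i 1 - K = J - K + Pi.single i 1 :=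
    fun K hK => by rw [tsub_add_eq_add_tsub hK]
  ext K
  rw [leib_apply, dcomp, Finsupp.add_apply, Finsupp.mapRange_apply, leib_apply]
  by_cases hK : K i = 0
  · rw [mapDomain_add_single_apply_of_eq_zero _ hK, MultiIndex.binom_add_single_of_eq_zero J hK]
    by_cases hJ : K ≤ J
    · rw [sub_eq K hJ, iter_add_single, Derivation.map_smul, add_zero]
    · simp [MultiIndex.binom_eq_zero hJ]
  · obtain ⟨L, rfl⟩ := MultiIndex.exists_eq_add_single hK
    rw [mapDomain_add_single_apply, MultiIndex.binom_add_single, leib_apply,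
      add_tsub_add_eq_tsub_right, Nat.cast_add, add_smul, add_comm]
    congr 1
    by_cases hJ : L + Pi.single i 1 ≤ J
    · rw [Derivation.map_smul, ← iter_add_single, ← sub_eq _ hJ, add_tsub_add_eq_tsub_right]
    · simp [MultiIndex.binom_eq_zero hJ]

theorem app_leib (J : MultiIndex n) (a b : A) : 𝒟.app (𝒟.leib J a) b = 𝒟.iter J (a * b) := by
  induction J using MultiIndex.induction_add_single with
  | zero => simp [leib_zero]
  | add K i ih => rw [leib_add_single, app_dcomp, ih, iter_add_single]

theorem dag_leib (J : MultiIndex n) (a b : A) : 𝒟.dag (𝒟.leib J a) b = a * 𝒟.negIter J b := by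
  induction J using MultiIndex.induction_add_single generalizing b with
  | zero => simp [leib_zero]
  | add K i ih => rw [leib_add_single, dag_dcomp, ih, negIter_add_single, mul_neg]

/-- The formal adjoint of `∑_K T^K D_K`, expanded by the Leibniz rule. -/
def adj (T : MultiIndex n →₀ A) : MultiIndex n →₀ A :=
  T.sum fun J t => (-1 : ℝ) ^ J.order • 𝒟.leib J t

theorem app_adj (a : A) : 𝒟.app (𝒟.adj T) a = 𝒟.dag T a := by
  rw [adj, Finsupp.sum, app_finset_sum]
  refine Finset.sum_congr rfl fun J _ => ?_
  rw [app_smul, app_leib]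
  rfl

/-- The adjoint is an involution: the adjoint of `D_J ∘ t` is `t (-D)_J`, and the two signs
`(-1)^{|J|}` cancel. -/
theorem dag_adj (a : A) : 𝒟.dag (𝒟.adj T) a = 𝒟.app T a := by
  rw [adj, Finsupp.sum, dag_finset_sum]
  refine Finset.sum_congr rfl fun J _ => ?_
  rw [dag_smul, dag_leib, negIter_apply, mul_smul_comm, smul_smul, ← mul_pow]
  simp

/-- The differential ideal generated by `g`. -/
def diffIdeal (g : A) : Ideal A := Ideal.span (Set.range fun K => 𝒟.iter K g)

variable {𝒟} in
theorem D_mem_diffIdeal {g a : A} (h : a ∈ 𝒟.diffIdeal g) (i : Fin n) :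
    𝒟.D i a ∈ 𝒟.diffIdeal g := by
  refine Submodule.span_induction ?_ ?_ ?_ ?_ h
  · rintro _ ⟨K, rfl⟩
    exact Ideal.subset_span ⟨K + Pi.single i 1, 𝒟.iter_add_single K i g⟩
  · simp
  · intro a b _ _ ha hb
    rw [map_add]
    exact Ideal.add_mem _ ha hb
  · intro c a ha hda
    rw [smul_eq_mul, Derivation.leibniz]
    refine Ideal.add_mem _ (Ideal.mul_mem_left _ _ hda) ?_
    rw [smul_eq_mul]
    exact Ideal.mul_mem_right _ _ ha

variable {𝒟} in
theorem iter_mem_diffIdeal {g a : A} (h : a ∈ 𝒟.diffIdeal g) (K : MultiIndex n) :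
    𝒟.iter K a ∈ 𝒟.diffIdeal g := by
  induction K using MultiIndex.induction_add_single with
  | zero => simpa
  | add K i ih => rw [iter_add_single]; exact D_mem_diffIdeal ih i

variable {𝒟} in
theorem app_mem_diffIdeal {g a : A} (h : a ∈ 𝒟.diffIdeal g) :
    𝒟.app T a ∈ 𝒟.diffIdeal g :=
  Ideal.sum_mem _ fun _ _ => Ideal.mul_mem_left _ _ (iter_mem_diffIdeal h _)

theorem self_mem_diffIdeal (g : A) : g ∈ 𝒟.diffIdeal g :=
  Ideal.subset_span ⟨0, 𝒟.iter_zero g⟩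

end CommDerivations

/-! ### Variational calculus in a ring with total and partial derivatives -/

/-- The algebraic structure of the ring of differential functions: total derivatives `D i` and
partial derivatives `pd K` along the jet coordinates, with their commutation relations. -/
structure JetDerivations (n : ℕ) (A : Type*) [CommRing A] [Algebra ℝ A] extends
    CommDerivations n A where
  /-- The partial derivatives along the jet coordinates. -/
  pd : MultiIndex n → Derivation ℝ A A
  pd_comm : ∀ J K a, pd J (pd K a) = pd K (pd J a)
  pd_add_single_D : ∀ K i a,
    pd (K + Pi.single i 1) (D i a) = D i (pd (K + Pi.single i 1) a) + pd K a
  pd_D_of_eq_zero : ∀ (K : MultiIndex n) i a, K i = 0 → pd K (D i a) = D i (pd K a)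
  finite_support : ∀ a, (Function.support fun K => pd K a).Finite

namespace JetDerivations

variable {n : ℕ} {A : Type*} [CommRing A] [Algebra ℝ A] (𝒥 : JetDerivations n A)

/-- The Frechet derivative. -/
def fr (a : A) : MultiIndex n →₀ A :=
  Finsupp.ofSupportFinite (fun K => 𝒥.pd K a) (𝒥.finite_support a)

@[simp] theorem fr_apply (a : A) (K : MultiIndex n) : 𝒥.fr a K = 𝒥.pd K a := rfl

theorem fr_add (a b : A) : 𝒥.fr (a + b) = 𝒥.fr a + 𝒥.fr b := by ext; simp

theorem fr_mul (a b : A) : 𝒥.fr (a * b) = a • 𝒥.fr b + b • 𝒥.fr a := by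
  ext; simp [Derivation.leibniz]

/-- The operator identity `(D_i a)' = D_i ∘ a'` packages the commutators of `∂_{u_K}` with `D_i`:
the extra `∂_{u_K}` in `[∂_{u_{K+i}}, D_i]` is the shifted part of `dcomp`. -/
theorem fr_D (i : Fin n) (a : A) : 𝒥.fr (𝒥.D i a) = 𝒥.dcomp i (𝒥.fr a) := by
  ext K
  rw [CommDerivations.dcomp, Finsupp.add_apply, Finsupp.mapRange_apply, fr_apply, fr_apply]
  by_cases hK : K i = 0
  · rw [CommDerivations.mapDomain_add_single_apply_of_eq_zero _ hK, 𝒥.pd_D_of_eq_zero K i a hK,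
      add_zero]
  · obtain ⟨L, rfl⟩ := MultiIndex.exists_eq_add_single hK
    rw [CommDerivations.mapDomain_add_single_apply, 𝒥.pd_add_single_D, fr_apply]

theorem dag_fr_iter (K : MultiIndex n) (a b : A) :
    𝒥.dag (𝒥.fr (𝒥.iter K a)) b = 𝒥.dag (𝒥.fr a) (𝒥.negIter K b) := by
  induction K using MultiIndex.induction_add_single generalizing b with
  | zero => simp
  | add K i ih =>
    rw [CommDerivations.iter_add_single, fr_D, CommDerivations.dag_dcomp, ih,
      CommDerivations.negIter_add_single, CommDerivations.dag, CommDerivations.dag,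
      Finsupp.sum, Finsupp.sum, ← Finset.sum_neg_distrib]
    simp

/-- The Euler--Lagrange operator. -/
def euler (a : A) : A := 𝒥.dag (𝒥.fr a) 1

theorem euler_add (a b : A) : 𝒥.euler (a + b) = 𝒥.euler a + 𝒥.euler b := by
  rw [euler, fr_add, CommDerivations.dag_add, euler, euler]

theorem euler_mul (a b : A) :
    𝒥.euler (a * b) = 𝒥.dag (𝒥.fr b) a + 𝒥.dag (𝒥.fr a) b := by
  rw [euler, fr_mul, CommDerivations.dag_add, CommDerivations.dag_smul_left,
    CommDerivations.dag_smul_left, mul_one, mul_one]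

/-- The adjoint of `D_i ∘ a'` is `-a'^* ∘ D_i`, and it is evaluated at the constant `1`, where `D_i
1 = 0`. -/
theorem euler_D (i : Fin n) (a : A) : 𝒥.euler (𝒥.D i a) = 0 := by
  rw [euler, fr_D, CommDerivations.dag_dcomp]
  simp [CommDerivations.dag]

theorem euler_eq_zero_of_mem_divergences {a : A} (h : a ∈ 𝒥.divergences) : 𝒥.euler a = 0 := by
  obtain ⟨Φ, rfl⟩ := (𝒥.mem_divergences_iff a).1 h
  have := map_sum (AddMonoidHom.mk' 𝒥.euler 𝒥.euler_add) (fun i => 𝒥.D i (Φ i)) Finset.univ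
  simp only [AddMonoidHom.mk'_apply] at this
  rw [this]
  exact Finset.sum_eq_zero fun i _ => 𝒥.euler_D i _

theorem euler_eq_of_sub_mem_divergences {a b : A} (h : a - b ∈ 𝒥.divergences) :
    𝒥.euler a = 𝒥.euler b := by
  have := 𝒥.euler_add (a - b) b
  rwa [𝒥.euler_eq_zero_of_mem_divergences h, sub_add_cancel, zero_add] at this

/-- The prolongation of the vector field `p ∂_u`. -/
def pr (p : A) : Derivation ℝ A A :=
  Derivation.mk'
    { toFun := fun a => 𝒥.app (𝒥.fr a) p
      map_add' := fun a b => by rw [fr_add, CommDerivations.app_add]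
      map_smul' := fun c a => by
        have : 𝒥.fr (c • a) = c • 𝒥.fr a := by ext; simp
        rw [this, CommDerivations.app_smul, RingHom.id_apply] }
    fun a b => by
      simp only [LinearMap.coe_mk, AddHom.coe_mk, smul_eq_mul]
      rw [fr_mul, CommDerivations.app_add, CommDerivations.app_smul_left,
        CommDerivations.app_smul_left]

theorem pr_apply (p a : A) : 𝒥.pr p a = 𝒥.app (𝒥.fr a) p := rfl

theorem pr_D (p a : A) (i : Fin n) : 𝒥.pr p (𝒥.D i a) = 𝒥.D i (𝒥.pr p a) := by
  rw [pr_apply, fr_D, CommDerivations.app_dcomp, pr_apply]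

theorem pr_iter (p a : A) (K : MultiIndex n) :
    𝒥.pr p (𝒥.iter K a) = 𝒥.iter K (𝒥.pr p a) := by
  induction K using MultiIndex.induction_add_single with
  | zero => simp
  | add K i ih => rw [CommDerivations.iter_add_single, pr_D, ih, CommDerivations.iter_add_single]

theorem pr_negIter (p a : A) (K : MultiIndex n) :
    𝒥.pr p (𝒥.negIter K a) = 𝒥.negIter K (𝒥.pr p a) := by
  rw [CommDerivations.negIter_apply, Derivation.map_smul, pr_iter, CommDerivations.negIter_apply]

/-- The prolongation of `p ∂_u` acting on the coefficients of an operator. -/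
def prOp (p : A) (T : MultiIndex n →₀ A) : MultiIndex n →₀ A :=
  T.mapRange (𝒥.pr p) (map_zero _)

theorem pr_app (p a : A) (T : MultiIndex n →₀ A) :
    𝒥.pr p (𝒥.app T a) = 𝒥.app (𝒥.prOp p T) a + 𝒥.app T (𝒥.pr p a) := by
  simp only [CommDerivations.app, prOp]
  rw [Finsupp.sum_mapRange_index (by simp), Finsupp.sum, Finsupp.sum, Finsupp.sum, map_sum,
    ← Finset.sum_add_distrib]
  refine Finset.sum_congr rfl fun K _ => ?_
  rw [Derivation.leibniz, pr_iter]
  simp only [smul_eq_mul]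
  ring

/-- Linearising `a'(p) = ∑ (∂a/∂u_K) D_K p` gives two operators: `pr_p` applied to the coefficients
of `a'`, because partial derivatives commute, and `∑ (∂a/∂u_K) D_K ∘ p'`. Their adjoints at `1` are
`pr_p(E_u a)`, because `pr_p` commutes with total derivatives, and `p'^*(E_u a)`. -/
theorem euler_pr (p a : A) :
    𝒥.euler (𝒥.pr p a) = 𝒥.pr p (𝒥.euler a) + 𝒥.dag (𝒥.fr p) (𝒥.euler a) := by
  have h1 : 𝒥.fr (𝒥.pr p a) = 𝒥.prOp p (𝒥.fr a) +
      ∑ K ∈ (𝒥.fr a).support, 𝒥.pd K a • 𝒥.fr (𝒥.iter K p) := by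
    ext J
    rw [fr_apply, pr_apply, CommDerivations.app, Finsupp.sum, map_sum, Finsupp.add_apply, prOp,
      Finsupp.mapRange_apply, Finsupp.finsetSum_apply, fr_apply, pr_apply, CommDerivations.app]
    -- Both sums can be taken over the support of `a'`: if `∂a/∂u_K = 0`, then `∂_{u_K}` of any
    -- `∂a/∂u_J` vanishes too.
    have h2 : (𝒥.fr (𝒥.pd J a)).sum (fun K t => t * 𝒥.iter K p) =
        ∑ K ∈ (𝒥.fr a).support, 𝒥.pd J (𝒥.pd K a) * 𝒥.iter K p := by
      rw [Finsupp.sum_of_support_subset (s := (𝒥.fr a).support) _ _ _ (by simp)]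
      · exact Finset.sum_congr rfl fun K _ => by rw [fr_apply, 𝒥.pd_comm]
      · intro K hK
        simp only [Finsupp.mem_support_iff, fr_apply] at hK ⊢
        contrapose! hK
        rw [𝒥.pd_comm, hK, map_zero]
    rw [h2, ← Finset.sum_add_distrib]
    refine Finset.sum_congr rfl fun K _ => ?_
    rw [Derivation.leibniz]
    simp only [smul_eq_mul, fr_apply, Finsupp.smul_apply]
    ring
  rw [euler, h1, CommDerivations.dag_add, CommDerivations.dag_finset_sum]
  congr 1
  · simp only [euler, CommDerivations.dag, prOp]
    rw [Finsupp.sum_mapRange_index (by simp), Finsupp.sum, Finsupp.sum, map_sum]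
    exact Finset.sum_congr rfl fun K _ => by rw [pr_negIter, mul_one, mul_one]
  · rw [Finset.sum_congr rfl fun K _ => by
      rw [CommDerivations.dag_smul_left, mul_one, dag_fr_iter]]
    have h3 := map_sum (AddMonoidHom.mk' (𝒥.dag (𝒥.fr p)) fun b c => by
      simp [CommDerivations.dag, Finsupp.sum, mul_add, Finset.sum_add_distrib])
      (fun K => 𝒥.negIter K (𝒥.pd K a)) (𝒥.fr a).support
    refine h3.symm.trans (congrArg (𝒥.dag (𝒥.fr p)) ?_)
    simp [euler, CommDerivations.dag, Finsupp.sum]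

/-- `q` is an adjoint-symmetry of `g = 0` with `g'^*(q) = R_q(g)`; then `S = R_q^* + q'` satisfies
`S^*(g) = E_u(q g)`. -/
theorem dag_adj_add_fr {g q : A} {Rq : MultiIndex n →₀ A}
    (hq : 𝒥.app (𝒥.adj (𝒥.fr g)) q = 𝒥.app Rq g) :
    𝒥.dag (𝒥.adj Rq + 𝒥.fr q) g = 𝒥.euler (q * g) := by
  rw [CommDerivations.dag_add, CommDerivations.dag_adj, ← hq, CommDerivations.app_adj, euler_mul]

/-- The variational derivative of `S(p) g` for a symmetry `p` and `S = R_q^* + q'`. -/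
theorem euler_app_mul {g p q : A} {Rp Rq : MultiIndex n →₀ A}
    (hp : 𝒥.app (𝒥.fr g) p = 𝒥.app Rp g) (hq : 𝒥.app (𝒥.adj (𝒥.fr g)) q = 𝒥.app Rq g) :
    𝒥.euler (𝒥.app (𝒥.adj Rq + 𝒥.fr q) p * g) =
      𝒥.app (𝒥.prOp p (𝒥.adj (𝒥.adj Rq + 𝒥.fr q))) g
        + 𝒥.app (𝒥.adj (𝒥.adj Rq + 𝒥.fr q)) (𝒥.app Rp g)
        + 𝒥.app (𝒥.adj (𝒥.fr p)) (𝒥.app (𝒥.adj (𝒥.adj Rq + 𝒥.fr q)) g) := by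
  set S := 𝒥.adj Rq + 𝒥.fr q with hS
  have hSg : 𝒥.app (𝒥.adj S) g = 𝒥.euler (q * g) := by
    rw [CommDerivations.app_adj, 𝒥.dag_adj_add_fr hq]
  -- First divergence: Green's identity for `S`, with `S^*(g) = E_u(q g)`.
  have h1 : 𝒥.app S p * g - p * 𝒥.euler (q * g) ∈ 𝒥.divergences := by
    rw [← 𝒥.dag_adj_add_fr hq]
    exact 𝒥.app_mul_sub_mul_dag_mem_divergences S p g
  -- Second divergence: Green's identity for the operator `(q g)'` against the constant `1`.
  have h2 : p * 𝒥.euler (q * g) - 𝒥.pr p (q * g) ∈ 𝒥.divergences := by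
    have := 𝒥.app_mul_sub_mul_dag_mem_divergences (𝒥.fr (q * g)) p 1
    rw [mul_one] at this
    convert Submodule.neg_mem _ this using 1
    rw [neg_sub, euler, pr_apply]
  rw [𝒥.euler_eq_of_sub_mem_divergences h1, 𝒥.euler_eq_of_sub_mem_divergences h2, euler_pr, ← hSg,
    pr_app, pr_apply 𝒥 p g, hp, CommDerivations.app_adj _ (𝒥.fr p)]

/-- `g'^*(S(p))` lies in the differential ideal of `g`. -/
theorem app_adj_fr_mem_diffIdeal {g p q : A} {Rp Rq : MultiIndex n →₀ A}
    (hp : 𝒥.app (𝒥.fr g) p = 𝒥.app Rp g) (hq : 𝒥.app (𝒥.adj (𝒥.fr g)) q = 𝒥.app Rq g) :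
    𝒥.app (𝒥.adj (𝒥.fr g)) (𝒥.app (𝒥.adj Rq + 𝒥.fr q) p) ∈ 𝒥.diffIdeal g := by
  have hg := 𝒥.self_mem_diffIdeal g
  have h := 𝒥.euler_app_mul hp hq
  -- The product rule splits the variational derivative as `g'^*(S(p)) + S(p)'^*(g)`; apart from the
  -- first summand, every term is an operator applied to an element of the ideal.
  rw [euler_mul, ← CommDerivations.app_adj, ← CommDerivations.app_adj] at h
  rw [eq_sub_of_add_eq h]
  exact Ideal.sub_mem _ (Ideal.add_mem _ (Ideal.add_mem _
    (CommDerivations.app_mem_diffIdeal _ hg)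
    (CommDerivations.app_mem_diffIdeal _ (CommDerivations.app_mem_diffIdeal _ hg)))
    (CommDerivations.app_mem_diffIdeal _ (CommDerivations.app_mem_diffIdeal _ hg)))
    (CommDerivations.app_mem_diffIdeal _ hg)

end JetDerivations

end JetCalculus

end

/-! ### Smooth cylinder functions and their line derivatives -/

noncomputable section

namespace JetCalculus

open Set Filter Topology
open scoped ContDiff

section Cylinder

variable {E E' : Type*} [AddCommGroup E] [Module ℝ E] [TopologicalSpace E]
  [AddCommGroup E'] [Module ℝ E'] [TopologicalSpace E']
  {H H' : Type} [NormedAddCommGroup H] [NormedSpace ℝ H]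
  [NormedAddCommGroup H'] [NormedSpace ℝ H']

/-- `f` factors on `U` through a continuous linear map to a normed space, as a smooth function. -/
def IsCyl (U : Set E) (f : E → H) : Prop :=
  ∃ (F : Type) (_ : NormedAddCommGroup F) (_ : NormedSpace ℝ F) (π : E →L[ℝ] F) (g : F → H),
    ∀ p ∈ U, ContDiffAt ℝ ∞ g (π p) ∧ f p = g (π p)

/-- All continuous linear images of `h` in normed spaces are smooth cylinder functions on `U`. -/
def IsCylMap (U : Set E') (h : E' → E) : Prop :=
  ∀ (F : Type) [NormedAddCommGroup F] [NormedSpace ℝ F] (π : E →L[ℝ] F), IsCyl U fun p => π (h p)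

/-- `w` is the derivative of `h` at `p` along `v`, tested on continuous linear maps. -/
def HasCylDerivAt {E' : Type*} [AddCommGroup E'] [Module ℝ E'] (h : E' → E)
    (w : E) (p v : E') : Prop :=
  ∀ (F : Type) [NormedAddCommGroup F] [NormedSpace ℝ F] (π : E →L[ℝ] F),
    HasLineDerivAt ℝ (fun q => π (h q)) (π w) p v

namespace IsCyl

variable {U U' : Set E} {f f₁ : E → H} {f' : E → H'}

theorem congr (hf : IsCyl U f) (h : ∀ p ∈ U, f₁ p = f p) : IsCyl U f₁ := by
  obtain ⟨F, _, _, π, g, hg⟩ := hf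
  exact ⟨F, _, _, π, g, fun p hp => ⟨(hg p hp).1, (h p hp).trans (hg p hp).2⟩⟩

theorem mono (hf : IsCyl U f) (h : U' ⊆ U) : IsCyl U' f := by
  obtain ⟨F, _, _, π, g, hg⟩ := hf
  exact ⟨F, _, _, π, g, fun p hp => hg p (h hp)⟩

theorem clm (U : Set E) (π : E →L[ℝ] H) : IsCyl U π :=
  ⟨H, _, _, π, id, fun _ _ => ⟨contDiffAt_id, rfl⟩⟩

theorem const (U : Set E) (c : H) : IsCyl U fun _ => c :=
  ⟨ℝ, _, _, 0, fun _ => c, fun _ _ => ⟨contDiffAt_const, rfl⟩⟩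

theorem prodMk (hf : IsCyl U f) (hf' : IsCyl U f') : IsCyl U fun p => (f p, f' p) := by
  obtain ⟨F, _, _, π, g, hg⟩ := hf
  obtain ⟨F', _, _, π', g', hg'⟩ := hf'
  refine ⟨F × F', _, _, π.prod π', fun y => (g y.1, g' y.2), fun p hp => ⟨?_, ?_⟩⟩
  · exact ((hg p hp).1.comp (π p, π' p) contDiffAt_fst).prodMk
      ((hg' p hp).1.comp (π p, π' p) contDiffAt_snd)
  · simp [(hg p hp).2, (hg' p hp).2]

theorem contDiffAt_comp (hf : IsCyl U f) {φ : H → H'} (hφ : ∀ p ∈ U, ContDiffAt ℝ ∞ φ (f p)) :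
    IsCyl U fun p => φ (f p) := by
  obtain ⟨F, _, _, π, g, hg⟩ := hf
  refine ⟨F, _, _, π, φ ∘ g, fun p hp => ⟨?_, congrArg φ (hg p hp).2⟩⟩
  refine ContDiffAt.comp (π p) ?_ (hg p hp).1
  rw [← (hg p hp).2]
  exact hφ p hp

theorem contDiff_comp (hf : IsCyl U f) {φ : H → H'} (hφ : ContDiff ℝ ∞ φ) :
    IsCyl U fun p => φ (f p) :=
  hf.contDiffAt_comp fun _ _ => hφ.contDiffAt

theorem add (hf : IsCyl U f) (hf₁ : IsCyl U f₁) : IsCyl U fun p => f p + f₁ p :=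
  (hf.prodMk hf₁).contDiff_comp (φ := fun y : H × H => y.1 + y.2) (by fun_prop)

theorem smul {c : E → ℝ} (hc : IsCyl U c) (hf : IsCyl U f) : IsCyl U fun p => c p • f p :=
  (hc.prodMk hf).contDiff_comp (φ := fun y : ℝ × H => y.1 • y.2) (by fun_prop)

theorem mul {f f₁ : E → ℝ} (hf : IsCyl U f) (hf₁ : IsCyl U f₁) : IsCyl U fun p => f p * f₁ p :=
  hf.smul hf₁

theorem sum {ι : Type*} (s : Finset ι) {F : ι → E → H} (h : ∀ i ∈ s, IsCyl U (F i)) :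
    IsCyl U fun p => ∑ i ∈ s, F i p := by
  classical
  induction s using Finset.induction_on with
  | empty => simpa using const U (0 : H)
  | insert i s hi ih =>
    simp only [Finset.sum_insert hi]
    exact (h i (by simp)).add (ih fun j hj => h j (by simp [hj]))

theorem comp {U' : Set E'} {h : E' → E} (hf : IsCyl U f) (hh : IsCylMap U' h)
    (hm : MapsTo h U' U) : IsCyl U' fun p => f (h p) := by
  obtain ⟨F, _, _, π, g, hg⟩ := hf
  refine ((hh F π).contDiffAt_comp (φ := g) fun p hp => (hg _ (hm hp)).1).congr
    fun p hp => (hg _ (hm hp)).2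

end IsCyl

theorem IsCylMap.clm (U : Set E') (A : E' →L[ℝ] E) : IsCylMap U A :=
  fun _ _ _ π => IsCyl.clm U (π.comp A)

theorem IsCylMap.const (U : Set E') (c : E) : IsCylMap U fun _ => c :=
  fun _ _ _ π => IsCyl.const U (π c)

theorem IsCylMap.add {U : Set E'} {h k : E' → E} (hh : IsCylMap U h) (hk : IsCylMap U k) :
    IsCylMap U fun p => h p + k p := fun F _ _ π => by
  simpa using (hh F π).add (hk F π)

theorem hasLineDerivAt_comp_clm {F : Type*} [NormedAddCommGroup F] [NormedSpace ℝ F]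
    (π : E →L[ℝ] F) {g : F → H} {p : E} (hg : DifferentiableAt ℝ g (π p)) (v : E) :
    HasLineDerivAt ℝ (fun q => g (π q)) (fderiv ℝ g (π p) (π v)) p v := by
  have := hg.hasFDerivAt.hasLineDerivAt (π v)
  refine HasDerivAt.congr_of_eventuallyEq this (Eventually.of_forall fun t => ?_)
  simp

theorem HasCylDerivAt.clm (A : E' →L[ℝ] E) (p v : E') : HasCylDerivAt A (A v) p v := by
  intro F _ _ π
  have h1 : HasDerivAt (fun t : ℝ => π (A p) + t • π (A v)) ((1 : ℝ) • π (A v)) 0 :=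
    ((hasDerivAt_id (0 : ℝ)).smul_const _).const_add _
  rw [one_smul] at h1
  refine HasDerivAt.congr_of_eventuallyEq h1 (Eventually.of_forall fun t => ?_)
  simp

theorem HasCylDerivAt.const {E' : Type*} [AddCommGroup E'] [Module ℝ E'] (c : E) (p v : E') :
    HasCylDerivAt (fun _ => c) 0 p v := by
  intro F _ _ π
  simpa [HasLineDerivAt] using hasDerivAt_const (0 : ℝ) (π c)

theorem HasCylDerivAt.add {E' : Type*} [AddCommGroup E'] [Module ℝ E']
    {h k : E' → E} {a b : E} {p v : E'} (hh : HasCylDerivAt h a p v)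
    (hk : HasCylDerivAt k b p v) : HasCylDerivAt (fun q => h q + k q) (a + b) p v := by
  intro F _ _ π
  have h := HasDerivAt.add (hh F π) (hk F π)
  simpa [HasLineDerivAt, Pi.add_def] using h

section Derivative

variable [ContinuousAdd E] [ContinuousSMul ℝ E] [ContinuousAdd E'] [ContinuousSMul ℝ E']
  {U : Set E} {f : E → H}

theorem eventually_add_smul_mem (hU : IsOpen U) {p : E} (hp : p ∈ U) (v : E) :
    ∀ᶠ t in 𝓝 (0 : ℝ), p + t • v ∈ U := by
  have hc : ContinuousAt (fun t : ℝ => p + t • v) 0 := by fun_prop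
  exact hc.preimage_mem_nhds (by simpa using hU.mem_nhds hp)

theorem hasLineDerivAt_congr (hU : IsOpen U) {p : E} (hp : p ∈ U) {v : E} {f₁ : E → H} {w : H}
    (h : ∀ q ∈ U, f₁ q = f q) (hf : HasLineDerivAt ℝ f w p v) : HasLineDerivAt ℝ f₁ w p v := by
  refine HasDerivAt.congr_of_eventuallyEq hf ?_
  filter_upwards [eventually_add_smul_mem hU hp v] with t ht using h _ ht

theorem lineDeriv_congr (hU : IsOpen U) {p : E} (hp : p ∈ U) {v : E} {f₁ : E → H}
    (h : ∀ q ∈ U, f₁ q = f q) : lineDeriv ℝ f₁ p v = lineDeriv ℝ f p v := by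
  refine Filter.EventuallyEq.deriv_eq ?_
  filter_upwards [eventually_add_smul_mem hU hp v] with t ht using h _ ht

theorem hasLineDerivAt_of_factor (hU : IsOpen U) {F : Type*} [NormedAddCommGroup F]
    [NormedSpace ℝ F] {π : E →L[ℝ] F} {g : F → H}
    (hg : ∀ p ∈ U, ContDiffAt ℝ ∞ g (π p) ∧ f p = g (π p)) {p : E} (hp : p ∈ U) (v : E) :
    HasLineDerivAt ℝ f (fderiv ℝ g (π p) (π v)) p v :=
  hasLineDerivAt_congr hU hp (fun q hq => (hg q hq).2)
    (hasLineDerivAt_comp_clm π ((hg p hp).1.differentiableAt (by simp)) v)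

/-- The derivative is a continuous linear map on all of `E`, being that of `g` composed with `π`. On
the jet space such a map sees only finitely many coordinates, which makes the sum defining `D_i`
finite. -/
theorem IsCyl.exists_deriv (hf : IsCyl U f) (hU : IsOpen U) {p : E} (hp : p ∈ U) :
    ∃ L : E →L[ℝ] H, ∀ v, HasLineDerivAt ℝ f (L v) p v := by
  obtain ⟨F, _, _, π, g, hg⟩ := hf
  exact ⟨(fderiv ℝ g (π p)).comp π, fun v => hasLineDerivAt_of_factor hU hg hp v⟩

theorem IsCyl.hasLineDerivAt (hf : IsCyl U f) (hU : IsOpen U) {p : E} (hp : p ∈ U) (v : E) :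
    HasLineDerivAt ℝ f (lineDeriv ℝ f p v) p v := by
  obtain ⟨L, hL⟩ := hf.exists_deriv hU hp
  rw [(hL v).lineDeriv]
  exact hL v

theorem IsCyl.lineDeriv (hf : IsCyl U f) (hU : IsOpen U) {V : E → E} (hV : IsCylMap U V) :
    IsCyl U fun p => lineDeriv ℝ f p (V p) := by
  obtain ⟨F, _, _, π, g, hg⟩ := hf
  have h1 : IsCyl U fun p => (fderiv ℝ g (π p), π (V p)) := by
    refine IsCyl.prodMk ?_ (hV F π)
    exact ⟨F, _, _, π, fderiv ℝ g, fun p hp => ⟨(hg p hp).1.fderiv_right (by simp), rfl⟩⟩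
  refine (h1.contDiff_comp (φ := fun y : (F →L[ℝ] H) × F => y.1 y.2)
    (isBoundedBilinearMap_apply.contDiff)).congr fun p hp => ?_
  exact (hasLineDerivAt_of_factor hU hg hp _).lineDeriv

theorem IsCyl.hasLineDerivAt_comp {U' : Set E'} {h : E' → E} (hf : IsCyl U f)
    (hU : IsOpen U) (hU' : IsOpen U') (hm : MapsTo h U' U) {p v : E'} {w : E} (hp : p ∈ U')
    (hh : HasCylDerivAt h w p v) :
    HasLineDerivAt ℝ (fun q => f (h q)) (_root_.lineDeriv ℝ f (h p) w) p v := by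
  obtain ⟨F, _, _, π, g, hg⟩ := hf
  rw [(hasLineDerivAt_of_factor hU hg (hm hp) w).lineDeriv]
  refine hasLineDerivAt_congr hU' hp (fun q hq => (hg _ (hm hq)).2) ?_
  have h1 : HasDerivAt (fun t : ℝ => π (h (p + t • v))) (π w) 0 := hh F π
  have h2 : DifferentiableAt ℝ g (π (h (p + (0 : ℝ) • v))) := by
    simpa using (hg _ (hm hp)).1.differentiableAt (by simp)
  have := h2.hasFDerivAt.comp_hasDerivAt (0 : ℝ) h1
  simpa [HasLineDerivAt, Function.comp_def] using this

/-- The bracket formula for two vector fields: the second-order terms agree by symmetry of the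
second derivative of `g`, leaving the derivatives of the fields along each other. All commutation
relations between `D_i` and `∂_{u_K}` come from this. -/
theorem IsCyl.lineDeriv_lineDeriv_sub (hf : IsCyl U f) (hU : IsOpen U) {V W : E → E} {p a b : E}
    (hp : p ∈ U) (hV : HasCylDerivAt V a p (W p)) (hW : HasCylDerivAt W b p (V p)) :
    _root_.lineDeriv ℝ (fun q => _root_.lineDeriv ℝ f q (W q)) p (V p) =
      _root_.lineDeriv ℝ (fun q => _root_.lineDeriv ℝ f q (V q)) p (W p)
        + _root_.lineDeriv ℝ f p b - _root_.lineDeriv ℝ f p a := by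
  obtain ⟨F, _, _, π, g, hg⟩ := hf
  have hl : ∀ q ∈ U, ∀ v, _root_.lineDeriv ℝ f q v = fderiv ℝ g (π q) (π v) :=
    fun q hq v => (hasLineDerivAt_of_factor hU hg hq v).lineDeriv
  have hg2 : DifferentiableAt ℝ (fderiv ℝ g) (π p) :=
    ((hg p hp).1.fderiv_right (m := 1) (WithTop.coe_le_coe.2 le_top)).differentiableAt (by simp)
  have key : ∀ (X : E → E) (v c : E), HasCylDerivAt X c p v →
      _root_.lineDeriv ℝ (fun q => _root_.lineDeriv ℝ f q (X q)) p v =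
        fderiv ℝ (fderiv ℝ g) (π p) (π v) (π (X p)) + fderiv ℝ g (π p) (π c) := by
    intro X v c hX
    refine (hasLineDerivAt_congr hU hp (fun q hq => hl q hq _) ?_).lineDeriv
    have h1 : HasDerivAt (fun t : ℝ => fderiv ℝ g (π (p + t • v)))
      (fderiv ℝ (fderiv ℝ g) (π p) (π v)) 0 := hasLineDerivAt_comp_clm π hg2 v
    have h2 : HasDerivAt (fun t : ℝ => π (X (p + t • v))) (π c) 0 := hX F π
    simpa [HasLineDerivAt] using h1.clm_apply h2
  rw [key W (V p) b hW, key V (W p) a hV, hl p hp, hl p hp]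
  have hs : IsSymmSndFDerivAt ℝ g (π p) :=
    (hg p hp).1.isSymmSndFDerivAt (by
      simp only [minSmoothness_of_isRCLikeNormedField]
      exact WithTop.coe_le_coe.2 (le_top : (2 : ℕ∞) ≤ ⊤))
  rw [hs.eq (π (V p)) (π (W p))]
  abel

end Derivative

/-- The algebra of smooth cylinder functions on `U`. -/
def cylAlg (U : Set E) : Subalgebra ℝ (U → ℝ) where
  carrier := {a | ∃ f : E → ℝ, IsCyl U f ∧ ∀ p : U, a p = f p}
  mul_mem' := by
    rintro a b ⟨f, hf, ha⟩ ⟨g, hg, hb⟩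
    exact ⟨_, hf.mul hg, fun p => by simp [ha, hb]⟩
  add_mem' := by
    rintro a b ⟨f, hf, ha⟩ ⟨g, hg, hb⟩
    exact ⟨_, hf.add hg, fun p => by simp [ha, hb]⟩
  algebraMap_mem' := fun c => ⟨_, IsCyl.const U c, fun p => rfl⟩

namespace cylAlg

variable {U : Set E}

/-- The class of a smooth cylinder function. -/
def mk (f : E → ℝ) (hf : IsCyl U f) : cylAlg U := ⟨fun p => f p, f, hf, fun _ => rfl⟩

@[simp] theorem mk_apply (f : E → ℝ) (hf : IsCyl U f) (p : U) : (mk f hf : U → ℝ) p = f p := rfl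

theorem mk_eq_mk {f g : E → ℝ} {hf : IsCyl U f} {hg : IsCyl U g} :
    mk f hf = mk g hg ↔ ∀ p ∈ U, f p = g p := by
  rw [Subtype.ext_iff, funext_iff, Subtype.forall]
  rfl

theorem exists_mk (a : cylAlg U) : ∃ f hf, a = mk f hf := by
  obtain ⟨a, f, hf, h⟩ := a
  exact ⟨f, hf, Subtype.ext (funext h)⟩

/-- A representative of an element of `cylAlg U`. -/
def rep (a : cylAlg U) : E → ℝ := Classical.choose (exists_mk a)

theorem isCyl_rep (a : cylAlg U) : IsCyl U (rep a) := (Classical.choose_spec (exists_mk a)).1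

theorem mk_rep (a : cylAlg U) : mk (rep a) (isCyl_rep a) = a :=
  (Classical.choose_spec (exists_mk a)).2.symm

theorem rep_apply (a : cylAlg U) {p : E} (hp : p ∈ U) : (rep a) p = (a : U → ℝ) ⟨p, hp⟩ := by
  conv_rhs => rw [← mk_rep a]
  rfl

variable [ContinuousAdd E] [ContinuousSMul ℝ E]

/-- The derivation of `cylAlg U` given by a vector field. -/
def deriv (hU : IsOpen U) (V : E → E) (hV : IsCylMap U V) : Derivation ℝ (cylAlg U) (cylAlg U) :=
  Derivation.mk'
    { toFun := fun a => mk (fun p => lineDeriv ℝ (rep a) p (V p)) ((isCyl_rep a).lineDeriv hU hV)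
      map_add' := fun a b => by
        ext ⟨p, hp⟩
        have h : HasLineDerivAt ℝ (fun q => rep a q + rep b q)
            (lineDeriv ℝ (rep a) p (V p) + lineDeriv ℝ (rep b) p (V p)) p (V p) :=
          HasDerivAt.add ((isCyl_rep a).hasLineDerivAt hU hp (V p))
            ((isCyl_rep b).hasLineDerivAt hU hp (V p))
        refine HasLineDerivAt.lineDeriv (hasLineDerivAt_congr hU hp (fun q hq => ?_) h)
        simp [rep_apply, hq]
      map_smul' := fun c a => by
        ext ⟨p, hp⟩
        have h : HasLineDerivAt ℝ (fun q => c • rep a q)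
            (c • lineDeriv ℝ (rep a) p (V p)) p (V p) :=
          HasDerivAt.const_smul c ((isCyl_rep a).hasLineDerivAt hU hp (V p))
        refine HasLineDerivAt.lineDeriv (hasLineDerivAt_congr hU hp (fun q hq => ?_) h)
        simp [rep_apply, hq] }
    fun a b => by
      ext ⟨p, hp⟩
      have h := HasDerivAt.mul ((isCyl_rep a).hasLineDerivAt hU hp (V p))
        ((isCyl_rep b).hasLineDerivAt hU hp (V p))
      refine (HasLineDerivAt.lineDeriv (hasLineDerivAt_congr hU hp
        (f := fun q => rep a q * rep b q) (fun q hq => ?_) h)).trans ?_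
      · simp [rep_apply, hq]
      · simp [rep_apply, hp]
        ring

/-- The chosen representative is immaterial: two representatives agree on the open set `U`, hence
near each of its points along every line. -/
theorem deriv_mk (hU : IsOpen U) (V : E → E) (hV : IsCylMap U V) (f : E → ℝ) (hf : IsCyl U f) :
    deriv hU V hV (mk f hf) = mk (fun p => lineDeriv ℝ f p (V p)) (hf.lineDeriv hU hV) :=
  Subtype.ext <| funext fun p => lineDeriv_congr hU p.2 fun _ hq => rep_apply _ hq

end cylAlg

end Cylinder

end JetCalculus

end

/-! ### The ring of differential functions on a jet domain -/

noncomputable section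

namespace JetCalculus

open Set Filter Topology
open scoped ContDiff

section JetSpace

variable {n : ℕ}

/-- The projection to finitely many jet coordinates, as a continuous linear map. -/
def projL (s : Finset (MultiIndex n)) : Jet n →L[ℝ] FinJet n s where
  toFun := proj s
  map_add' _ _ := rfl
  map_smul' _ _ := rfl
  cont := by unfold proj; fun_prop

@[simp] theorem projL_apply (s : Finset (MultiIndex n)) (p : Jet n) : projL s p = proj s p := rfl

/-- The section of `proj s` that sets all the other jet coordinates to zero. -/
def extL (s : Finset (MultiIndex n)) : FinJet n s →L[ℝ] Jet n where
  toFun y := (y.1, fun K => if h : K ∈ s then y.2 ⟨K, h⟩ else 0)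
  map_add' y z := by
    refine Prod.ext rfl (funext fun K => ?_)
    by_cases h : K ∈ s <;> simp [h]
  map_smul' c y := by
    refine Prod.ext rfl (funext fun K => ?_)
    by_cases h : K ∈ s <;> simp [h]
  cont := by
    refine continuous_fst.prodMk (continuous_pi fun K => ?_)
    by_cases h : K ∈ s
    · simp only [h, dif_pos]; fun_prop
    · simp only [h]; exact continuous_const

theorem proj_extL (s : Finset (MultiIndex n)) (y : FinJet n s) : proj s (extL s y) = y := by
  refine Prod.ext rfl (funext fun K => ?_)
  simp [proj, extL]

theorem continuous_proj (s : Finset (MultiIndex n)) : Continuous (proj s) := (projL s).continuous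

/-- Points near `proj s p` lift continuously to `p + extL s (y - proj s p)`. Openness of the image
turns smoothness on `proj s '' U` into smoothness at each of its points. -/
theorem isOpenMap_proj (s : Finset (MultiIndex n)) : IsOpenMap (proj s) := by
  intro U hU
  rw [isOpen_iff_mem_nhds]
  rintro _ ⟨p, hp, rfl⟩
  have hc : ContinuousAt (fun y => p + extL s (y - proj s p)) (proj s p) := by fun_prop
  have hU' : U ∈ 𝓝 (p + extL s (proj s p - proj s p)) := by simpa using hU.mem_nhds hp
  filter_upwards [hc.preimage_mem_nhds hU'] with y hy
  refine ⟨_, hy, ?_⟩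
  rw [← projL_apply, map_add, projL_apply, projL_apply, proj_extL, add_sub_cancel]

theorem IsJetDomain.isOpen {U : Set (Jet n)} (hU : IsJetDomain U) : IsOpen U := by
  obtain ⟨s, V, hV, rfl⟩ := hU
  exact hV.preimage (continuous_proj s)

/-- A continuous linear map from the jet space to a normed space only depends on `x` and finitely
many jet coordinates. -/
theorem exists_clm_factor {F : Type*} [NormedAddCommGroup F] [NormedSpace ℝ F]
    (π : Jet n →L[ℝ] F) : ∃ s : Finset (MultiIndex n), ∀ p, π p = π (extL s (proj s p)) := by
  -- A neighbourhood of `0` in the product topology restricts only finitely many coordinates.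
  -- Vectors vanishing on these can be scaled freely with image of norm below `1`, so their image is
  -- `0`.
  have h1 : {w : MultiIndex n → ℝ | ‖π (0, w)‖ < 1} ∈ 𝓝 0 := by
    have hc : Continuous fun w : MultiIndex n → ℝ => ‖π (0, w)‖ := by fun_prop
    refine (isOpen_lt hc continuous_const).mem_nhds ?_
    change ‖π 0‖ < 1
    simp
  rw [nhds_pi, Filter.mem_pi'] at h1
  obtain ⟨s, t, ht, hsub⟩ := h1
  have h2 : ∀ w : MultiIndex n → ℝ, (∀ K ∈ s, w K = 0) → π (0, w) = 0 := by
    intro w hw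
    have h3 : ∀ c : ℝ, |c| * ‖π (0, w)‖ < 1 := by
      intro c
      have : c • w ∈ Set.pi (s : Set (MultiIndex n)) t := fun K hK => by
        simpa [hw K hK] using mem_of_mem_nhds (ht K)
      have := hsub this
      simp only [mem_ofPred_eq] at this
      rwa [show ((0 : Fin n → ℝ), c • w) = c • ((0 : Fin n → ℝ), w) by simp, map_smul,
        norm_smul, Real.norm_eq_abs] at this
    by_contra hne
    have hpos : 0 < ‖π (0, w)‖ := norm_pos_iff.2 hne
    have := h3 ‖π (0, w)‖⁻¹
    rw [abs_of_pos (inv_pos.2 hpos), inv_mul_cancel₀ hpos.ne'] at this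
    exact lt_irrefl _ this
  refine ⟨s, fun p => ?_⟩
  rw [← sub_eq_zero, ← map_sub]
  have h4 : p - extL s (proj s p) = (0, (p - extL s (proj s p)).2) :=
    Prod.ext (by simp [extL, proj]) rfl
  rw [h4]
  refine h2 _ fun K hK => ?_
  simp [extL, proj, hK]

theorem extL_proj_eq_sum (s : Finset (MultiIndex n)) (p : Jet n) :
    extL s (proj s p) = (p.1, 0) + ∑ K ∈ s, p.2 K • ((0, Pi.single K 1) : Jet n) := by
  refine Prod.ext (by simp [extL, proj, Prod.fst_sum]) (funext fun L => ?_)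
  simp [extL, proj, Prod.snd_sum, Finset.sum_apply, Pi.single_apply]

theorem exists_clm_eq_sum {F : Type*} [NormedAddCommGroup F] [NormedSpace ℝ F]
    (π : Jet n →L[ℝ] F) : ∃ s : Finset (MultiIndex n), (∀ K ∉ s, π (0, Pi.single K 1) = 0) ∧
      ∀ p : Jet n, π p = π (p.1, 0) + ∑ K ∈ s, p.2 K • π (0, Pi.single K 1) := by
  obtain ⟨s, hs⟩ := exists_clm_factor π
  have h : ∀ p : Jet n, π p = π (p.1, 0) + ∑ K ∈ s, p.2 K • π (0, Pi.single K 1) := by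
    intro p
    rw [hs p, extL_proj_eq_sum, map_add, map_sum]
    simp only [map_smul]
  refine ⟨s, fun K hK => ?_, h⟩
  rw [h]
  have h0 : π ((0 : Fin n → ℝ), (0 : MultiIndex n → ℝ)) = 0 := map_zero π
  simp only [h0, zero_add]
  refine Finset.sum_eq_zero fun L hL => ?_
  have : L ≠ K := fun h => hK (h ▸ hL)
  simp [this]

section Maps

variable {E : Type*} [AddCommGroup E] [Module ℝ E] [TopologicalSpace E]

/-- A continuous linear map to a normed space reads only finitely many jet coordinates, so it
suffices to test coordinatewise. -/
theorem isCylMap_jet {U : Set E} {h : E → Jet n} (h1 : IsCyl U fun p => (h p).1)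
    (h2 : ∀ K, IsCyl U fun p => (h p).2 K) : IsCylMap U h := by
  intro F _ _ π
  obtain ⟨s, -, hs⟩ := exists_clm_eq_sum π
  have h3 : IsCyl U fun p => π ((h p).1, 0) :=
    h1.contDiff_comp (φ := fun y => π (y, 0))
      (π.comp (ContinuousLinearMap.inl ℝ (Fin n → ℝ) (MultiIndex n → ℝ))).contDiff
  exact (h3.add (IsCyl.sum s fun K _ => (h2 K).smul (IsCyl.const U _))).congr fun p _ => hs (h p)

theorem hasCylDerivAt_jet {E : Type*} [AddCommGroup E] [Module ℝ E]
    {h : E → Jet n} {w : Jet n} {p v : E}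
    (h1 : HasLineDerivAt ℝ (fun q => (h q).1) w.1 p v)
    (h2 : ∀ K, HasLineDerivAt ℝ (fun q => (h q).2 K) (w.2 K) p v) : HasCylDerivAt h w p v := by
  intro F _ _ π
  obtain ⟨s, -, hs⟩ := exists_clm_eq_sum π
  have h3 : HasDerivAt (fun t : ℝ => π ((h (p + t • v)).1, 0)) (π (w.1, 0)) 0 :=
    (π.comp (ContinuousLinearMap.inl ℝ (Fin n → ℝ) (MultiIndex n → ℝ))).hasFDerivAt.comp_hasDerivAt
      0 h1
  have h4 := h3.fun_add (HasDerivAt.fun_sum (u := s) fun K _ =>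
    HasDerivAt.smul_const (h2 K) (π (0, Pi.single K 1)))
  rw [← hs] at h4
  exact h4.congr_of_eventuallyEq (Eventually.of_forall fun t => hs _)

end Maps

theorem IsDiffFun.isCyl {U : Set (Jet n)} (hU : IsOpen U) {f : Jet n → ℝ} (hf : IsDiffFun U f) :
    IsCyl U f := by
  obtain ⟨s, g, hg, hfg⟩ := hf
  refine ⟨FinJet n s, _, _, projL s, g, fun p hp => ⟨?_, hfg p hp⟩⟩
  exact hg.contDiffAt ((isOpenMap_proj s U hU).mem_nhds ⟨p, hp, rfl⟩)

theorem IsCyl.isDiffFun {U : Set (Jet n)} {f : Jet n → ℝ} (hf : IsCyl U f) :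
    IsDiffFun U f := by
  obtain ⟨F, _, _, π, g, hg⟩ := hf
  obtain ⟨s, hs⟩ := exists_clm_factor π
  refine ⟨s, fun y => g (π (extL s y)), ?_, fun p hp => ?_⟩
  · rintro _ ⟨p, hp, rfl⟩
    have h := (hg p hp).1
    rw [hs] at h
    exact (ContDiffAt.comp (proj s p) h
      (π.comp (extL s)).contDiff.contDiffAt).contDiffWithinAt
  · rw [(hg p hp).2, hs]

/-- The linear part of the total derivative, as a vector field on the jet space. -/
def shiftL (i : Fin n) : Jet n →L[ℝ] Jet n where
  toFun p := (0, fun K => p.2 (K + Pi.single i 1))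
  map_add' p q := by ext <;> simp
  map_smul' c p := by ext <;> simp
  cont := by fun_prop

theorem shiftL_apply (i : Fin n) (p : Jet n) :
    shiftL i p = (0, fun K => p.2 (K + Pi.single i 1)) := rfl

/-- The total derivative, as a vector field on the jet space. -/
def totalField (i : Fin n) (p : Jet n) : Jet n := (Pi.single i 1, 0) + shiftL i p

theorem totalField_apply (i : Fin n) (p : Jet n) :
    totalField i p = (Pi.single i 1, fun K => p.2 (K + Pi.single i 1)) := by
  simp [totalField, shiftL_apply]

theorem isCylMap_totalField (U : Set (Jet n)) (i : Fin n) : IsCylMap U (totalField i) :=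
  (IsCylMap.const U _).add (IsCylMap.clm U _)

theorem hasCylDerivAt_totalField (i : Fin n) (p v : Jet n) :
    HasCylDerivAt (totalField i) (shiftL i v) p v := by
  have h := (HasCylDerivAt.const (E := Jet n) (Pi.single i 1, 0) p v).add
    (HasCylDerivAt.clm (shiftL i) p v)
  rwa [zero_add] at h

theorem partialX_eq_lineDeriv (i : Fin n) (f : Jet n → ℝ) (p : Jet n) :
    partialX i f p = lineDeriv ℝ f p (Pi.single i 1, 0) := by
  have h := deriv_comp_sub_const (f := fun t : ℝ => f (p + t • ((Pi.single i 1, 0) : Jet n)))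
    (p.1 i) (p.1 i)
  rw [sub_self] at h
  rw [lineDeriv, ← h, partialX]
  congr 1
  funext t
  congr 1
  refine Prod.ext (funext fun j => ?_) (by simp)
  by_cases hj : j = i
  · subst hj; simp
  · simp [hj]

theorem partialU_eq_lineDeriv (K : MultiIndex n) (f : Jet n → ℝ) (p : Jet n) :
    partialU K f p = lineDeriv ℝ f p (0, Pi.single K 1) := by
  have h := deriv_comp_sub_const (f := fun t : ℝ => f (p + t • ((0, Pi.single K 1) : Jet n)))
    (p.2 K) (p.2 K)
  rw [sub_self] at h
  rw [lineDeriv, ← h, partialU]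
  congr 1
  funext t
  congr 1
  refine Prod.ext (by simp) (funext fun L => ?_)
  by_cases hL : L = K
  · subst hL; simp
  · simp [hL]

theorem totalDeriv_eq_lineDeriv {U : Set (Jet n)} (hU : IsOpen U) {f : Jet n → ℝ}
    (hf : IsCyl U f) (i : Fin n) {p : Jet n} (hp : p ∈ U) :
    totalDeriv i f p = lineDeriv ℝ f p (totalField i p) := by
  obtain ⟨L, hL⟩ := hf.exists_deriv hU hp
  obtain ⟨s, hs0, hs⟩ := exists_clm_eq_sum L
  rw [totalDeriv, partialX_eq_lineDeriv, (hL _).lineDeriv, (hL _).lineDeriv, hs (totalField i p),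
    totalField_apply]
  congr 1
  rw [finsum_eq_sum_of_support_subset (s := s)]
  · refine Finset.sum_congr rfl fun K _ => ?_
    rw [partialU_eq_lineDeriv, (hL _).lineDeriv, smul_eq_mul]
  · intro K hK
    by_contra hKs
    rw [Function.mem_support, partialU_eq_lineDeriv, (hL _).lineDeriv, hs0 K hKs] at hK
    simp at hK

theorem shiftL_single_of_eq_zero {K : MultiIndex n} {i : Fin n} (h : K i = 0) :
    shiftL i ((0, Pi.single K 1) : Jet n) = 0 := by
  rw [shiftL_apply]
  refine Prod.ext rfl (funext fun L => ?_)
  have : L + Pi.single i 1 ≠ K := by rintro rfl; simp at h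
  simp [this]

theorem shiftL_single_add_single (K : MultiIndex n) (i : Fin n) :
    shiftL i ((0, Pi.single (K + Pi.single i 1) 1) : Jet n) = (0, Pi.single K 1) := by
  rw [shiftL_apply]
  refine Prod.ext rfl (funext fun L => ?_)
  simp [Pi.single_apply]

/-- The ring of differential functions on `U`, with its total and partial derivatives. -/
def jetAlg {U : Set (Jet n)} (hU : IsOpen U) : JetDerivations n (cylAlg U) where
  D i := cylAlg.deriv hU (totalField i) (isCylMap_totalField U i)
  pd K := cylAlg.deriv hU (fun _ => (0, Pi.single K 1)) (IsCylMap.const U _)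
  comm i j a := by
    obtain ⟨f, hf, rfl⟩ := cylAlg.exists_mk a
    simp only [cylAlg.deriv_mk, cylAlg.mk_eq_mk]
    intro p hp
    rw [hf.lineDeriv_lineDeriv_sub hU hp (hasCylDerivAt_totalField i p (totalField j p))
      (hasCylDerivAt_totalField j p (totalField i p))]
    -- The total derivative fields commute: both sides have components `u_{K+i+j}`.
    have : shiftL i (totalField j p) = shiftL j (totalField i p) := by
      simp only [totalField_apply, shiftL_apply, add_right_comm _ (Pi.single i 1)]
    rw [this, add_sub_cancel_right]
  pd_comm J K a := by
    obtain ⟨f, hf, rfl⟩ := cylAlg.exists_mk a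
    simp only [cylAlg.deriv_mk, cylAlg.mk_eq_mk]
    intro p hp
    rw [hf.lineDeriv_lineDeriv_sub hU hp (HasCylDerivAt.const _ _ _)
      (HasCylDerivAt.const _ _ _), add_sub_cancel_right]
  pd_add_single_D K i a := by
    obtain ⟨f, hf, rfl⟩ := cylAlg.exists_mk a
    simp only [cylAlg.deriv_mk]
    ext ⟨p, hp⟩
    refine (hf.lineDeriv_lineDeriv_sub hU hp (HasCylDerivAt.const _ _ _)
      (hasCylDerivAt_totalField i p _)).trans ?_
    rw [shiftL_single_add_single, lineDeriv_zero, sub_zero]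
    rfl
  pd_D_of_eq_zero K i a h := by
    obtain ⟨f, hf, rfl⟩ := cylAlg.exists_mk a
    simp only [cylAlg.deriv_mk]
    ext ⟨p, hp⟩
    refine (hf.lineDeriv_lineDeriv_sub hU hp (HasCylDerivAt.const _ _ _)
      (hasCylDerivAt_totalField i p _)).trans ?_
    rw [shiftL_single_of_eq_zero h, add_sub_cancel_right]
    rfl
  finite_support a := by
    obtain ⟨f, hf, rfl⟩ := cylAlg.exists_mk a
    simp only [cylAlg.deriv_mk]
    obtain ⟨F, _, _, π, g, hg⟩ := id hf
    obtain ⟨s, hs, -⟩ := exists_clm_eq_sum π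
    refine s.finite_toSet.subset fun K hK => ?_
    by_contra hKs
    refine hK (Subtype.ext (funext fun p => ?_))
    refine (hasLineDerivAt_of_factor hU hg p.2 _).lineDeriv.trans ?_
    rw [hs K hKs, map_zero]
    rfl

end JetSpace

end JetCalculus

end

/-! ### Translation between concrete functions and ring elements -/

noncomputable section

namespace JetCalculus

open Set

variable {n : ℕ} {U : Set (Jet n)}

/-- The element `a` of the ring of differential functions on `U` is the restriction of `f`. -/
def Represents (f : Jet n → ℝ) (a : cylAlg U) : Prop := ∀ p : U, (a : U → ℝ) p = f p

/-- The coefficients of `T` are the restrictions of those of `R`. -/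
def RepresentsOp (R : DiffOp n) (T : MultiIndex n →₀ cylAlg U) : Prop :=
  ∀ K, Represents (R K) (T K)

theorem represents_mk {f : Jet n → ℝ} (hf : IsCyl U f) : Represents f (cylAlg.mk f hf) :=
  fun _ => rfl

theorem IsDiffFun.exists_represents (hU : IsOpen U) {f : Jet n → ℝ} (hf : IsDiffFun U f) :
    ∃ a : cylAlg U, Represents f a := ⟨_, represents_mk (hf.isCyl hU)⟩

namespace Represents

variable {f g : Jet n → ℝ} {a b : cylAlg U}

theorem isCyl (h : Represents f a) : IsCyl U f :=
  (cylAlg.isCyl_rep a).congr fun p hp => by rw [cylAlg.rep_apply a hp, h]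

theorem isDiffFun (h : Represents f a) : IsDiffFun U f := h.isCyl.isDiffFun

theorem eq_mk (h : Represents f a) : a = cylAlg.mk f h.isCyl := Subtype.ext (funext h)

theorem apply (h : Represents f a) {p : Jet n} (hp : p ∈ U) : (a : U → ℝ) ⟨p, hp⟩ = f p := h ⟨p, hp⟩

theorem congr (h : Represents f a) (hfg : ∀ p ∈ U, g p = f p) : Represents g a :=
  fun p => (h p).trans (hfg p p.2).symm

theorem eq_iff (h : Represents f a) (h' : Represents g b) : a = b ↔ ∀ p ∈ U, f p = g p := by
  rw [Subtype.ext_iff, funext_iff, Subtype.forall]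
  simp only [h.apply, h'.apply]

theorem eq_zero_iff (h : Represents f a) : a = 0 ↔ ∀ p ∈ U, f p = 0 :=
  h.eq_iff (g := 0) fun _ => rfl

theorem add (h : Represents f a) (h' : Represents g b) :
    Represents (fun p => f p + g p) (a + b) := fun p => by simp [h p, h' p]

theorem mul (h : Represents f a) (h' : Represents g b) :
    Represents (fun p => f p * g p) (a * b) := fun p => by simp [h p, h' p]

theorem totalDeriv (hU : IsOpen U) (h : Represents f a) (i : Fin n) :
    Represents (JetCalculus.totalDeriv i f) ((jetAlg hU).D i a) := by
  intro p
  rw [h.eq_mk, totalDeriv_eq_lineDeriv hU h.isCyl i p.2]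
  exact congrFun (congrArg Subtype.val (cylAlg.deriv_mk hU (totalField i)
    (isCylMap_totalField U i) f h.isCyl)) p

theorem partialU (hU : IsOpen U) (h : Represents f a) (K : MultiIndex n) :
    Represents (JetCalculus.partialU K f) ((jetAlg hU).pd K a) := by
  intro p
  rw [h.eq_mk, partialU_eq_lineDeriv]
  exact congrFun (congrArg Subtype.val
    (cylAlg.deriv_mk hU (fun _ => (0, Pi.single K 1)) (IsCylMap.const U _) f h.isCyl)) p

theorem totalDerivs (hU : IsOpen U) (h : Represents f a) (J : MultiIndex n) :
    Represents (JetCalculus.totalDerivs J f) ((jetAlg hU).iter J a) := by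
  rw [CommDerivations.iter_apply_eq_foldr, JetCalculus.totalDerivs]
  induction List.finRange n with
  | nil => exact h
  | cons i l ih =>
    rw [List.foldr_cons, List.foldr_cons]
    generalize J i = k
    induction k with
    | zero => exact ih
    | succ k ihk =>
      rw [Function.iterate_succ_apply', Function.iterate_succ_apply']
      exact ihk.totalDeriv hU i

theorem frechet (hU : IsOpen U) (h : Represents f a) :
    RepresentsOp (JetCalculus.frechet f) ((jetAlg hU).fr a) := fun K => h.partialU hU K

/-- The summands vanish on `U` outside the support of `T`, so the `finsum` is a genuine finite sum
and not the default value `0`. -/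
theorem finsupp_sum {φ : MultiIndex n → cylAlg U → cylAlg U} {F : MultiIndex n → Jet n → ℝ}
    (T : MultiIndex n →₀ cylAlg U) (h0 : ∀ K, φ K 0 = 0)
    (h : ∀ K, Represents (F K) (φ K (T K))) :
    Represents (fun p => ∑ᶠ K, F K p) (T.sum φ) := by
  intro p
  change _ = ∑ᶠ K, F K p
  rw [finsum_eq_sum_of_support_subset (s := T.support)]
  · rw [Finsupp.sum, AddSubmonoidClass.coe_finsetSum, Finset.sum_apply]
    exact Finset.sum_congr rfl fun K _ => h K p
  · intro K hK
    by_contra hT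
    rw [Finset.mem_coe, Finsupp.notMem_support_iff] at hT
    rw [Function.mem_support, ← h K p, hT, h0] at hK
    exact hK rfl

end Represents

namespace RepresentsOp

variable {R R' : DiffOp n} {S T : MultiIndex n →₀ cylAlg U} {f g : Jet n → ℝ} {a b : cylAlg U}

theorem add (h : RepresentsOp R S) (h' : RepresentsOp R' T) : RepresentsOp (R + R') (S + T) :=
  fun K => (h K).add (h' K)

theorem apply (hU : IsOpen U) (h : RepresentsOp R T) (hf : Represents f a) :
    Represents (R.apply f) ((jetAlg hU).app T a) :=
  Represents.finsupp_sum T (by simp) fun K => (h K).mul (hf.totalDerivs hU K)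

theorem adjoint (hU : IsOpen U) (h : RepresentsOp R T) :
    RepresentsOp R.adjoint ((jetAlg hU).adj T) := by
  intro K
  have h1 : (jetAlg hU).adj T K = T.sum fun J t =>
      ((-1 : ℝ) ^ J.order * (J.binom K : ℝ)) • (jetAlg hU).iter (J - K) t := by
    rw [CommDerivations.adj, Finsupp.sum, Finsupp.finsetSum_apply]
    refine Finset.sum_congr rfl fun J _ => ?_
    rw [Finsupp.smul_apply, CommDerivations.leib_apply, smul_smul]
  have h2 : ∀ J, Represents
      (fun p => (-1 : ℝ) ^ J.order * (J.binom K : ℝ) * totalDerivs (J - K) (R J) p)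
      (((-1 : ℝ) ^ J.order * (J.binom K : ℝ)) • (jetAlg hU).iter (J - K) (T J)) := fun J p => by
    change _ * ((jetAlg hU).iter (J - K) (T J) : U → ℝ) p = _
    rw [(h J).totalDerivs hU (J - K) p]
  rw [h1]
  refine (Represents.finsupp_sum T (by simp) h2).congr fun p _ => ?_
  -- The ring adjoint sums over all `J`, the concrete one over `J = K + L`; the remaining `J` carry
  -- a zero binomial.
  have h3 : ∀ J : MultiIndex n, J ∉ Set.range (K + ·) → J.binom K = 0 := fun J hJ =>
    MultiIndex.binom_eq_zero fun hle => hJ ⟨J - K, add_tsub_cancel_of_le hle⟩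
  set φ : MultiIndex n → ℝ := fun J =>
    (-1 : ℝ) ^ J.order * (J.binom K : ℝ) * totalDerivs (J - K) (R J) p with hφ
  have h4 : R.adjoint K p = ∑ᶠ L, φ (K + L) := by simp [DiffOp.adjoint, hφ]
  rw [h4, ← finsum_mem_range (f := φ) (add_right_injective K), ← finsum_mem_univ φ]
  refine finsum_mem_inter_support_eq φ _ _ ?_
  rw [Set.univ_inter, Set.inter_eq_right]
  intro J hJ
  by_contra hJK
  rw [Function.mem_support, hφ] at hJ
  simp [h3 J hJK] at hJ

theorem prolong (hU : IsOpen U) (hf : Represents f a) (hg : Represents g b) :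
    Represents (prolong f g) ((jetAlg hU).pr a b) :=
  RepresentsOp.apply hU (hg.frechet hU) hf

theorem prolongOp (hU : IsOpen U) (hf : Represents f a) (h : RepresentsOp R T) :
    RepresentsOp (prolongOp f R) ((jetAlg hU).prOp a T) :=
  fun K => prolong hU hf (h K)

end RepresentsOp

theorem Represents.eulerLagrange (hU : IsOpen U) {f : Jet n → ℝ} {a : cylAlg U}
    (h : Represents f a) : Represents (eulerLagrange f) ((jetAlg hU).euler a) := by
  refine Represents.finsupp_sum (φ := fun K t => (jetAlg hU).negIter K (t * 1))
    ((jetAlg hU).fr a) (by simp) fun K p => ?_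
  rw [mul_one, CommDerivations.negIter_apply, ← (h.partialU hU K).totalDerivs hU K p]
  rfl

theorem IsDiffOp.exists_represents (hU : IsOpen U) {R : DiffOp n} (hR : IsDiffOp U R) :
    ∃ T : MultiIndex n →₀ cylAlg U, RepresentsOp R T := by
  obtain ⟨h, s, hs⟩ := hR
  refine ⟨Finsupp.onFinset s (fun K => cylAlg.mk (R K) ((h K).isCyl hU)) fun K hK => ?_,
    fun K => represents_mk ((h K).isCyl hU)⟩
  by_contra hKs
  exact hK ((represents_mk ((h K).isCyl hU)).eq_zero_iff.2 (hs K hKs))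

theorem Represents.isTotalDivergence_iff (hU : IsOpen U) {f : Jet n → ℝ} {a : cylAlg U}
    (h : Represents f a) : IsTotalDivergence U f ↔ a ∈ (jetAlg hU).divergences := by
  have hsum : ∀ (Φ : Fin n → Jet n → ℝ) (Ψ : Fin n → cylAlg U), (∀ i, Represents (Φ i) (Ψ i)) →
      Represents (fun p => ∑ i, JetCalculus.totalDeriv i (Φ i) p) (∑ i, (jetAlg hU).D i (Ψ i)) := by
    intro Φ Ψ hΦ p
    rw [AddSubmonoidClass.coe_finsetSum, Finset.sum_apply]
    exact Finset.sum_congr rfl fun i _ => (hΦ i).totalDeriv hU i p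
  rw [CommDerivations.mem_divergences_iff]
  constructor
  · rintro ⟨Φ, hΦ, hf⟩
    exact ⟨fun i => cylAlg.mk (Φ i) ((hΦ i).isCyl hU),
      ((hsum Φ _ fun i => represents_mk _).eq_iff h).2 hf⟩
  · rintro ⟨Ψ, hΨ⟩
    have hrep : ∀ i, Represents (cylAlg.rep (Ψ i)) (Ψ i) := fun i p =>
      (cylAlg.rep_apply _ p.2).symm
    exact ⟨fun i => cylAlg.rep (Ψ i), fun i => (hrep i).isDiffFun,
      ((hsum _ _ hrep).eq_iff h).1 hΨ⟩

end JetCalculus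

end

/-! ### Smoothness of integrals over a parameter -/

noncomputable section

namespace JetCalculus

open Set Filter Topology MeasureTheory
open scoped ContDiff

section ParametricIntegral

variable {F H : Type} [NormedAddCommGroup F] [NormedSpace ℝ F]
  [NormedAddCommGroup H] [NormedSpace ℝ H]

theorem uIoc_zero_one_subset : Set.uIoc (0 : ℝ) 1 ⊆ Icc 0 1 := by
  rw [uIoc_of_le zero_le_one]
  exact Ioc_subset_Icc_self

/-- Tube lemma over the compact interval. The order `k` is finite because smoothness of finite order
at a point persists nearby. -/
theorem eventually_contDiffAt_translate {k : ℕ} {g : F → H} {c y : F}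
    (hg : ∀ t ∈ Icc (0 : ℝ) 1, ContDiffAt ℝ k g (t • c + y)) :
    ∀ᶠ z in 𝓝 y, ∀ t ∈ Icc (0 : ℝ) 1, ContDiffAt ℝ k g (t • c + z) := by
  refine isCompact_Icc.eventually_forall_of_forall_eventually fun t ht => ?_
  have hcont : ContinuousAt (fun q : F × ℝ => q.2 • c + q.1) (y, t) := by fun_prop
  exact hcont.eventually ((hg t ht).eventually (by simp))

theorem continuousOn_fderiv_translate {g : F → H} {c y : F}
    (hg : ∀ t ∈ Icc (0 : ℝ) 1, ContDiffAt ℝ 1 g (t • c + y)) :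
    ContinuousOn (fun t : ℝ => fderiv ℝ g (t • c + y)) (Icc 0 1) := fun t ht =>
  (ContinuousAt.comp (f := fun t : ℝ => t • c + y)
    ((hg t ht).fderiv_right (m := 0) (by simp)).continuousAt (by fun_prop)).continuousWithinAt

theorem hasFDerivAt_integral_translate {g : F → H} {c y : F}
    (hg : ∀ t ∈ Icc (0 : ℝ) 1, ContDiffAt ℝ 1 g (t • c + y)) :
    HasFDerivAt (fun z => ∫ t in (0 : ℝ)..1, g (t • c + z))
      (∫ t in (0 : ℝ)..1, fderiv ℝ g (t • c + y)) y := by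
  have hloc : ∀ᶠ z in 𝓝 y, ∀ t ∈ Icc (0 : ℝ) 1, ContDiffAt ℝ 1 g (t • c + z) := by
    simpa using eventually_contDiffAt_translate (k := 1) (by simpa using hg)
  obtain ⟨C, hC⟩ := (isCompact_Icc.image_of_continuousOn
    (continuousOn_fderiv_translate hg)).isBounded.exists_norm_le
  -- `C` bounds the derivative on the segment through `y`; the slack `1` makes the bound strict
  -- there, hence stable near `y`. It dominates the integrand.
  have hbd : ∀ᶠ z in 𝓝 y, ∀ t ∈ Icc (0 : ℝ) 1, ‖fderiv ℝ g (t • c + z)‖ ≤ C + 1 := by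
    refine isCompact_Icc.eventually_forall_of_forall_eventually fun t ht => ?_
    have h1 : ContinuousAt (fun q : F × ℝ => ‖fderiv ℝ g (q.2 • c + q.1)‖) (y, t) :=
      (ContinuousAt.comp (f := fun q : F × ℝ => q.2 • c + q.1)
        ((hg t ht).fderiv_right (m := 0) (by simp)).continuousAt (by fun_prop)).norm
    have h2 : ‖fderiv ℝ g (t • c + y)‖ < C + 1 := (hC _ ⟨t, ht, rfl⟩).trans_lt (by simp)
    exact (h1.eventually_lt continuousAt_const h2).mono fun q hq => hq.le
  have hcontOn : ∀ z, (∀ t ∈ Icc (0 : ℝ) 1, ContDiffAt ℝ 1 g (t • c + z)) →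
      ContinuousOn (fun t : ℝ => g (t • c + z)) (Icc 0 1) := fun z hz t ht =>
    (ContinuousAt.comp (f := fun t : ℝ => t • c + z) (hz t ht).continuousAt
      (by fun_prop)).continuousWithinAt
  have hmeas : ∀ {H' : Type} [NormedAddCommGroup H'] {k : ℝ → H'}, ContinuousOn k (Icc 0 1) →
      AEStronglyMeasurable k (volume.restrict (Set.uIoc (0 : ℝ) 1)) := fun hk =>
    (hk.aestronglyMeasurable measurableSet_Icc).mono_measure
      (Measure.restrict_mono uIoc_zero_one_subset le_rfl)
  refine intervalIntegral.hasFDerivAt_integral_of_dominated_of_fderiv_le (𝕜 := ℝ)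
    (F' := fun z t => fderiv ℝ g (t • c + z)) (bound := fun _ => C + 1)
    (Filter.inter_mem hloc hbd) (hloc.mono fun z hz => hmeas (hcontOn z hz)) ?_
    (hmeas (continuousOn_fderiv_translate hg)) ?_ intervalIntegrable_const ?_
  · refine ContinuousOn.intervalIntegrable ?_
    rw [uIcc_of_le zero_le_one]
    exact hcontOn y hg
  · exact Eventually.of_forall fun t ht z hz => hz.2 t (uIoc_zero_one_subset ht)
  · refine Eventually.of_forall fun t ht z hz => ?_
    have h1 := ((hz.1 t (uIoc_zero_one_subset ht)).differentiableAt (by simp)).hasFDerivAt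
    simpa [Function.comp_def] using h1.comp z ((hasFDerivAt_id z).const_add (t • c))

/-- Induction by differentiating under the integral. One order of smoothness is spent at the start;
the target `H` varies, since the derivative takes values in `F →L[ℝ] H`. -/
theorem contDiffAt_integral_translate_nat (k : ℕ) {H : Type} [NormedAddCommGroup H]
    [NormedSpace ℝ H] {g : F → H} {c y : F}
    (hg : ∀ t ∈ Icc (0 : ℝ) 1, ContDiffAt ℝ (k + 1 : ℕ) g (t • c + y)) :
    ContDiffAt ℝ k (fun z => ∫ t in (0 : ℝ)..1, g (t • c + z)) y := by
  have hloc : ∃ u ∈ 𝓝 y, ∀ z ∈ u, HasFDerivAt (fun z => ∫ t in (0 : ℝ)..1, g (t • c + z))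
      (∫ t in (0 : ℝ)..1, fderiv ℝ g (t • c + z)) z := by
    refine Eventually.exists_mem ?_
    filter_upwards [eventually_contDiffAt_translate hg] with z hz
    exact hasFDerivAt_integral_translate fun t ht => (hz t ht).of_le (by norm_cast; omega)
  induction k generalizing H with
  | zero =>
    obtain ⟨u, hu, h⟩ := hloc
    exact contDiffAt_zero.2 ⟨u, hu, fun z hz => (h z hz).continuousAt.continuousWithinAt⟩
  | succ k ih =>
    have hg' : ∀ t ∈ Icc (0 : ℝ) 1, ContDiffAt ℝ (k + 1 : ℕ) (fderiv ℝ g) (t • c + y) :=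
      fun t ht => (hg t ht).fderiv_right (by norm_cast)
    refine contDiffAt_succ_iff_hasFDerivAt.2 ⟨fun z => ∫ t in (0 : ℝ)..1, fderiv ℝ g (t • c + z),
      hloc, ih hg' (Eventually.exists_mem ?_)⟩
    filter_upwards [eventually_contDiffAt_translate hg'] with z hz
    exact hasFDerivAt_integral_translate fun t ht => (hz t ht).of_le (by norm_cast; omega)

theorem contDiffAt_integral_translate {g : F → H} {c y : F}
    (hg : ∀ t ∈ Icc (0 : ℝ) 1, ContDiffAt ℝ ∞ g (t • c + y)) :
    ContDiffAt ℝ ∞ (fun z => ∫ t in (0 : ℝ)..1, g (t • c + z)) y :=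
  contDiffAt_infty.2 fun k => contDiffAt_integral_translate_nat k fun t ht =>
    contDiffAt_infty.1 (hg t ht) (k + 1)

end ParametricIntegral

/-! ### Integrating divergences that depend on a parameter -/

section Homotopy

variable {n : ℕ}

theorem IsCyl.continuousOn {E : Type*} [AddCommGroup E] [Module ℝ E] [TopologicalSpace E]
    {U : Set E} {f : E → ℝ} (hf : IsCyl U f) : ContinuousOn f U := by
  obtain ⟨F, _, _, π, g, hg⟩ := hf
  refine ContinuousOn.congr (f := fun p => g (π p)) (fun p hp => ?_) fun p hp => (hg p hp).2
  exact (ContinuousAt.comp (hg p hp).1.continuousAt π.continuous.continuousAt).continuousWithinAt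

/-- The total derivative, as a vector field on the product of the parameter line with the jet
space. -/
def paramField (i : Fin n) (q : ℝ × Jet n) : ℝ × Jet n :=
  (0, (Pi.single i 1, 0)) +
    ((ContinuousLinearMap.inr ℝ ℝ (Jet n)).comp
      ((shiftL i).comp (ContinuousLinearMap.snd ℝ ℝ (Jet n)))) q

theorem paramField_apply (i : Fin n) (q : ℝ × Jet n) : paramField i q = (0, totalField i q.2) := by
  simp [paramField, totalField]

theorem isCylMap_paramField (W : Set (ℝ × Jet n)) (i : Fin n) : IsCylMap W (paramField i) :=
  (IsCylMap.const W _).add (IsCylMap.clm W _)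

theorem hasCylDerivAt_paramField (i : Fin n) (q v : ℝ × Jet n) :
    HasCylDerivAt (paramField i) (0, shiftL i v.2) q v := by
  have h := (HasCylDerivAt.const (E := ℝ × Jet n) (0, (Pi.single i 1, 0)) q v).add
    (HasCylDerivAt.clm ((ContinuousLinearMap.inr ℝ ℝ (Jet n)).comp
      ((shiftL i).comp (ContinuousLinearMap.snd ℝ ℝ (Jet n)))) q v)
  rwa [zero_add] at h

/-- The ring of differential functions depending on a parameter, with its total derivatives. -/
def paramAlg {W : Set (ℝ × Jet n)} (hW : IsOpen W) : CommDerivations n (cylAlg W) where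
  D i := cylAlg.deriv hW (paramField i) (isCylMap_paramField W i)
  comm i j a := by
    obtain ⟨f, hf, rfl⟩ := cylAlg.exists_mk a
    simp only [cylAlg.deriv_mk, cylAlg.mk_eq_mk]
    intro p hp
    rw [hf.lineDeriv_lineDeriv_sub hW hp (hasCylDerivAt_paramField i p (paramField j p))
      (hasCylDerivAt_paramField j p (paramField i p))]
    have : shiftL i (paramField j p).2 = shiftL j (paramField i p).2 := by
      simp only [paramField_apply, totalField_apply, shiftL_apply,
        add_right_comm _ (Pi.single i 1)]
    rw [this, add_sub_cancel_right]

theorem paramAlg_D_mk {W : Set (ℝ × Jet n)} (hW : IsOpen W) (i : Fin n) {f : ℝ × Jet n → ℝ}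
    (hf : IsCyl W f) : (paramAlg hW).D i (cylAlg.mk f hf) =
      cylAlg.mk (fun q => lineDeriv ℝ f q (paramField i q))
        (hf.lineDeriv hW (isCylMap_paramField W i)) :=
  cylAlg.deriv_mk hW (paramField i) (isCylMap_paramField W i) f hf

variable {V : Set (Jet n)} {W : Set (ℝ × Jet n)}

/-- A continuous linear map on `ℝ × Jet n` has the form `(t, p) ↦ t • c + π' p`, so the integral
factors through `π'` as the integral of `g` over translates. -/
theorem IsCyl.integral (hV : IsOpen V) (hVW : ∀ t ∈ Icc (0 : ℝ) 1, ∀ p ∈ V, (t, p) ∈ W)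
    (hW : IsOpen W) {Ψ : ℝ × Jet n → ℝ} (hΨ : IsCyl W Ψ) :
    IsCyl V (fun p => ∫ t in (0 : ℝ)..1, Ψ (t, p)) ∧ ∀ p ∈ V, ∀ v,
      _root_.lineDeriv ℝ (fun p => ∫ t in (0 : ℝ)..1, Ψ (t, p)) p v =
        ∫ t in (0 : ℝ)..1, _root_.lineDeriv ℝ Ψ (t, p) (0, v) := by
  obtain ⟨F, _, _, π, g, hg⟩ := hΨ
  set π' : Jet n →L[ℝ] F := π.comp (ContinuousLinearMap.inr ℝ ℝ (Jet n)) with hπ'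
  set c : F := π (1, 0) with hc
  have hπ : ∀ (t : ℝ) (p : Jet n), π (t, p) = t • c + π' p := fun t p => by
    rw [hc, hπ', ContinuousLinearMap.comp_apply, ← map_smul, ← map_add]
    simp
  have hsm : ∀ p ∈ V, ∀ t ∈ Icc (0 : ℝ) 1, ContDiffAt ℝ ∞ g (t • c + π' p) := fun p hp t ht => by
    rw [← hπ]; exact (hg _ (hVW t ht p hp)).1
  have hfac : ∀ p ∈ V, ContDiffAt ℝ ∞ (fun z => ∫ t in (0 : ℝ)..1, g (t • c + z)) (π' p) ∧
      ∫ t in (0 : ℝ)..1, Ψ (t, p) = ∫ t in (0 : ℝ)..1, g (t • c + π' p) := fun p hp => by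
    refine ⟨contDiffAt_integral_translate (hsm p hp), ?_⟩
    refine intervalIntegral.integral_congr fun t ht => ?_
    rw [uIcc_of_le zero_le_one] at ht
    simp only [(hg _ (hVW t ht p hp)).2, hπ]
  refine ⟨⟨F, _, _, π', _, hfac⟩, fun p hp v => ?_⟩
  have hsm1 : ∀ t ∈ Icc (0 : ℝ) 1, ContDiffAt ℝ 1 g (t • c + π' p) :=
    fun t ht => (hsm p hp t ht).of_le (by simp)
  rw [(hasLineDerivAt_of_factor hV hfac hp v).lineDeriv,
    (hasFDerivAt_integral_translate hsm1).fderiv, ContinuousLinearMap.intervalIntegral_apply]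
  · refine intervalIntegral.integral_congr fun t ht => ?_
    rw [uIcc_of_le zero_le_one] at ht
    rw [(hasLineDerivAt_of_factor hW hg (hVW t ht p hp) _).lineDeriv, hπ, hπ, zero_smul, zero_add]
  · refine ContinuousOn.intervalIntegrable ?_
    rw [uIcc_of_le zero_le_one]
    exact continuousOn_fderiv_translate hsm1

/-- If the derivative of `θ` with respect to the parameter is a total divergence, then so is the
difference of the values of `θ` at the ends of the unit interval. -/
theorem isTotalDivergence_of_param (hV : IsOpen V)
    (hVW : ∀ t ∈ Icc (0 : ℝ) 1, ∀ p ∈ V, (t, p) ∈ W) (hW : IsOpen W) {θ : ℝ × Jet n → ℝ}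
    (hθ : IsCyl W θ)
    (hdiv : cylAlg.mk (fun q => lineDeriv ℝ θ q (1, 0)) (hθ.lineDeriv hW (IsCylMap.const W (1, 0)))
      ∈ (paramAlg hW).divergences) :
    IsTotalDivergence V fun p => θ (1, p) - θ (0, p) := by
  obtain ⟨Ψ, hΨ⟩ := (CommDerivations.mem_divergences_iff _ _).1 hdiv
  set ψ : Fin n → ℝ × Jet n → ℝ := fun i => cylAlg.rep (Ψ i) with hψ
  have hψc : ∀ i, IsCyl W (ψ i) := fun i => cylAlg.isCyl_rep _
  have hsum : ∀ q ∈ W, ∑ i, lineDeriv ℝ (ψ i) q (0, totalField i q.2) =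
      lineDeriv ℝ θ q (1, 0) := by
    intro q hq
    have h := congrFun (congrArg Subtype.val hΨ) ⟨q, hq⟩
    rw [cylAlg.mk_apply, AddSubmonoidClass.coe_finsetSum, Finset.sum_apply] at h
    rw [← h]
    refine Finset.sum_congr rfl fun i _ => ?_
    rw [← paramField_apply, ← cylAlg.mk_rep (Ψ i), paramAlg_D_mk]
    rfl
  have hcont : ∀ {f : ℝ × Jet n → ℝ}, IsCyl W f → ∀ p ∈ V,
      IntervalIntegrable (fun t => f (t, p)) volume 0 1 := by
    intro f hf p hp
    refine ContinuousOn.intervalIntegrable ?_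
    rw [uIcc_of_le zero_le_one]
    exact hf.continuousOn.comp (by fun_prop) fun t ht => hVW t ht p hp
  refine ⟨fun i p => ∫ t in (0 : ℝ)..1, ψ i (t, p),
    fun i => ((hψc i).integral hV hVW hW).1.isDiffFun, fun p hp => ?_⟩
  have h1 : ∀ i, totalDeriv i (fun p => ∫ t in (0 : ℝ)..1, ψ i (t, p)) p =
      ∫ t in (0 : ℝ)..1, lineDeriv ℝ (ψ i) (t, p) (0, totalField i p) := fun i => by
    rw [totalDeriv_eq_lineDeriv hV ((hψc i).integral hV hVW hW).1 i hp,
      ((hψc i).integral hV hVW hW).2 p hp]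
  have h2 : ∀ i, IntervalIntegrable
      (fun t => lineDeriv ℝ (ψ i) (t, p) (0, totalField i p)) volume 0 1 := fun i => by
    have := hcont ((hψc i).lineDeriv hW (isCylMap_paramField W i)) p hp
    simpa only [paramField_apply] using this
  rw [Finset.sum_congr rfl fun i _ => h1 i, ← intervalIntegral.integral_finsetSum fun i _ => h2 i]
  -- The divergence of the integrated currents is the integral of `∂θ/∂t`, evaluated by the
  -- fundamental theorem of calculus.
  rw [intervalIntegral.integral_congr (g := fun t => lineDeriv ℝ θ (t, p) (1, 0))]
  · refine intervalIntegral.integral_eq_sub_of_hasDerivAt (f := fun t => θ (t, p)) ?_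
      (hcont (hθ.lineDeriv hW (IsCylMap.const W (1, 0))) p hp)
    intro t ht
    rw [uIcc_of_le zero_le_one] at ht
    have h3 : HasDerivAt (fun s : ℝ => θ ((t, p) + s • (1, 0))) (lineDeriv ℝ θ (t, p) (1, 0)) 0 :=
      hθ.hasLineDerivAt hW (hVW t ht p hp) (1, 0)
    have h4 : HasDerivAt (fun s : ℝ => θ ((t, p) + s • (1, 0))) (lineDeriv ℝ θ (t, p) (1, 0))
      (t - t) := by rwa [sub_self]
    simpa using h4.comp_sub_const t t
  · intro t ht
    rw [uIcc_of_le zero_le_one] at ht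
    exact hsum _ (hVW t ht p hp)

end Homotopy

end JetCalculus

end

/-! ### The two homotopies: to a section, and along it -/

noncomputable section

namespace JetCalculus

open Set Filter Topology
open scoped ContDiff

variable {n : ℕ} {U V : Set (Jet n)}

theorem lineDeriv_eq_finsum (hU : IsOpen U) {f : Jet n → ℝ} (hf : IsCyl U f) {p : Jet n}
    (hp : p ∈ U) (w : MultiIndex n → ℝ) :
    lineDeriv ℝ f p (0, w) = ∑ᶠ K, w K * partialU K f p := by
  obtain ⟨L, hL⟩ := hf.exists_deriv hU hp
  obtain ⟨s, hs0, hs⟩ := exists_clm_eq_sum L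
  have h0 : L ((0 : Fin n → ℝ), (0 : MultiIndex n → ℝ)) = 0 := map_zero L
  rw [(hL _).lineDeriv, hs, h0, zero_add, finsum_eq_sum_of_support_subset (s := s)]
  · refine Finset.sum_congr rfl fun K _ => ?_
    rw [partialU_eq_lineDeriv, (hL _).lineDeriv, smul_eq_mul]
  · intro K hK
    by_contra hKs
    rw [Function.mem_support, partialU_eq_lineDeriv, (hL _).lineDeriv, hs0 K hKs] at hK
    simp at hK

/-- A holonomic section of the jet space: a smooth function of `x` together with all of its
derivatives. -/
structure IsHolonomic (j : (Fin n → ℝ) → MultiIndex n → ℝ) : Prop where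
  contDiff : ∀ K, ContDiff ℝ ∞ fun x => j x K
  fderiv_single : ∀ K i x, fderiv ℝ (fun x => j x K) x (Pi.single i 1) = j x (K + Pi.single i 1)

namespace IsHolonomic

variable {j : (Fin n → ℝ) → MultiIndex n → ℝ}

theorem continuous (hj : IsHolonomic j) : Continuous j :=
  continuous_pi fun K => (hj.contDiff K).continuous

theorem hasDerivAt_comp (hj : IsHolonomic j) {y : ℝ → Fin n → ℝ} {t r : ℝ} {i : Fin n}
    (hy : HasDerivAt y (r • Pi.single i 1) t) (K : MultiIndex n) :
    HasDerivAt (fun s => j (y s) K) (r * j (y t) (K + Pi.single i 1)) t := by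
  have h := ((hj.contDiff K).differentiable (by simp) (y t)).hasFDerivAt.comp_hasDerivAt t hy
  rwa [map_smul, hj.fderiv_single, smul_eq_mul] at h

/-- The fibrewise homotopy contracting the jet space to a section `j`. -/
def contract (j : (Fin n → ℝ) → MultiIndex n → ℝ) (q : ℝ × Jet n) : Jet n :=
  (q.2.1, fun K => j q.2.1 K + q.1 * (q.2.2 K - j q.2.1 K))

theorem continuous_contract (hj : IsHolonomic j) : Continuous (contract j) := by
  refine (by fun_prop : Continuous fun q : ℝ × Jet n => q.2.1).prodMk (continuous_pi fun K => ?_)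
  have := (hj.contDiff K).continuous
  fun_prop

theorem isCyl_section (hj : IsHolonomic j) (W : Set (ℝ × Jet n)) (K : MultiIndex n) :
    IsCyl W fun q => j q.2.1 K :=
  (IsCyl.clm W ((ContinuousLinearMap.fst ℝ (Fin n → ℝ) (MultiIndex n → ℝ)).comp
    (ContinuousLinearMap.snd ℝ ℝ (Jet n)))).contDiff_comp (hj.contDiff K)

theorem isCyl_param (W : Set (ℝ × Jet n)) : IsCyl W fun q => q.1 :=
  IsCyl.clm W (ContinuousLinearMap.fst ℝ ℝ (Jet n))

theorem isCyl_x (W : Set (ℝ × Jet n)) : IsCyl W fun q => q.2.1 :=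
  IsCyl.clm W ((ContinuousLinearMap.fst ℝ (Fin n → ℝ) (MultiIndex n → ℝ)).comp
    (ContinuousLinearMap.snd ℝ ℝ (Jet n)))

theorem isCyl_u (W : Set (ℝ × Jet n)) (K : MultiIndex n) : IsCyl W fun q => q.2.2 K :=
  IsCyl.clm W ((ContinuousLinearMap.proj K).comp
    ((ContinuousLinearMap.snd ℝ (Fin n → ℝ) (MultiIndex n → ℝ)).comp
      (ContinuousLinearMap.snd ℝ ℝ (Jet n))))

theorem isCyl_sub (hj : IsHolonomic j) (W : Set (ℝ × Jet n)) (K : MultiIndex n) :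
    IsCyl W fun q => q.2.2 K - j q.2.1 K :=
  ((isCyl_u W K).prodMk (hj.isCyl_section W K)).contDiff_comp
    (φ := fun y : ℝ × ℝ => y.1 - y.2) (by fun_prop)

theorem isCylMap_contract (hj : IsHolonomic j) (W : Set (ℝ × Jet n)) :
    IsCylMap W (contract j) :=
  isCylMap_jet (isCyl_x W) fun K =>
    (hj.isCyl_section W K).add ((isCyl_param W).mul (hj.isCyl_sub W K))

theorem hasDerivAt_add_smul {E : Type*} [NormedAddCommGroup E] [NormedSpace ℝ E] (a v : E) :
    HasDerivAt (fun t : ℝ => a + t • v) v 0 := by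
  simpa using ((hasDerivAt_id (0 : ℝ)).smul_const v).const_add a

theorem hasDerivAt_u (K : MultiIndex n) (q v : ℝ × Jet n) :
    HasDerivAt (fun t : ℝ => (q + t • v).2.2 K) (v.2.2 K) 0 :=
  hasDerivAt_add_smul (q.2.2 K) (v.2.2 K)

theorem hasDerivAt_section (hj : IsHolonomic j) (K : MultiIndex n) (i : Fin n) (q : ℝ × Jet n) :
    HasDerivAt (fun t : ℝ => j (q + t • paramField i q).2.1 K) (j q.2.1 (K + Pi.single i 1)) 0 := by
  have hy : HasDerivAt (fun t : ℝ => (q + t • paramField i q).2.1)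
      ((1 : ℝ) • (Pi.single i 1 : Fin n → ℝ)) 0 := by
    simpa [paramField_apply, totalField_apply] using
      hasDerivAt_add_smul q.2.1 (Pi.single i 1 : Fin n → ℝ)
  simpa using hj.hasDerivAt_comp hy K

/-- Holonomy of `j` makes the contraction carry total derivatives to total derivatives:
differentiating `j_K + t (u_K - j_K)` along `D_i` raises the index `K` in every term. -/
theorem hasCylDerivAt_contract_paramField (hj : IsHolonomic j) (i : Fin n) (q : ℝ × Jet n) :
    HasCylDerivAt (contract j) (totalField i (contract j q)) q (paramField i q) := by
  refine hasCylDerivAt_jet ?_ fun K => ?_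
  · simpa [HasLineDerivAt, contract, totalField_apply, paramField_apply] using
      hasDerivAt_add_smul q.2.1 (Pi.single i 1 : Fin n → ℝ)
  · have h1 := hj.hasDerivAt_section K i q
    have h2 := hasDerivAt_u K q (paramField i q)
    have h3 := h1.fun_add ((h2.fun_sub h1).const_mul q.1)
    simpa [HasLineDerivAt, contract, totalField_apply, paramField_apply] using h3

theorem hasCylDerivAt_contract_param (j : (Fin n → ℝ) → MultiIndex n → ℝ) (q : ℝ × Jet n) :
    HasCylDerivAt (contract j) (0, fun K => q.2.2 K - j q.2.1 K) q (1, 0) := by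
  refine hasCylDerivAt_jet ?_ fun K => ?_
  · simpa [HasLineDerivAt, contract] using hasDerivAt_const (0 : ℝ) q.2.1
  · have h := ((hasDerivAt_add_smul q.1 1).mul_const (q.2.2 K - j q.2.1 K)).const_add (j q.2.1 K)
    simpa [HasLineDerivAt, contract] using h

end IsHolonomic

/-- Pull-back of differential functions along a map. -/
def cylAlg.pull {W : Set (ℝ × Jet n)} {h : ℝ × Jet n → Jet n} (hh : IsCylMap W h)
    (hm : MapsTo h W U) : cylAlg U →+ cylAlg W where
  toFun a := ⟨fun q => (a : U → ℝ) ⟨h q, hm q.2⟩, _, (cylAlg.isCyl_rep a).comp hh hm,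
    fun q => (cylAlg.rep_apply a (hm q.2)).symm⟩
  map_zero' := rfl
  map_add' _ _ := rfl

theorem cylAlg.pull_mk {W : Set (ℝ × Jet n)} {h : ℝ × Jet n → Jet n} (hh : IsCylMap W h)
    (hm : MapsTo h W U) {f : Jet n → ℝ} (hf : IsCyl U f) :
    cylAlg.pull hh hm (cylAlg.mk f hf) = cylAlg.mk (fun q => f (h q)) (hf.comp hh hm) := rfl

/-- If `E_u(f) = 0`, then the variation of `f` between a holonomic section `j` and a jet is a total
divergence. -/
theorem IsHolonomic.isTotalDivergence_sub {j : (Fin n → ℝ) → MultiIndex n → ℝ}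
    (hj : IsHolonomic j) (hU : IsOpen U) (hV : IsOpen V) {f : Jet n → ℝ} (hf : IsCyl U f)
    (hE : ∀ p ∈ U, eulerLagrange f p = 0)
    (hVU : ∀ t ∈ Icc (0 : ℝ) 1, ∀ p ∈ V, IsHolonomic.contract j (t, p) ∈ U) :
    IsTotalDivergence V fun p => f p - f (p.1, j p.1) := by
  set h := IsHolonomic.contract j with hh
  set W := h ⁻¹' U with hWdef
  have hW : IsOpen W := hU.preimage hj.continuous_contract
  have hm : MapsTo h W U := fun q hq => hq
  have hc : IsCylMap W h := hj.isCylMap_contract W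
  set pull := cylAlg.pull hc hm with hpull
  -- Pull-back along the contraction intertwines the total derivatives, hence also adjoints.
  have hD : ∀ i a, pull ((jetAlg hU).D i a) = (paramAlg hW).D i (pull a) := by
    intro i a
    obtain ⟨g, hg, rfl⟩ := cylAlg.exists_mk a
    rw [hpull, cylAlg.pull_mk, paramAlg_D_mk]
    refine Eq.trans (congrArg pull (cylAlg.deriv_mk hU (totalField i) (isCylMap_totalField U i)
      g hg)) ?_
    rw [hpull, cylAlg.pull_mk, cylAlg.mk_eq_mk]
    exact fun q hq => (hg.hasLineDerivAt_comp hU hW hm hq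
      (hj.hasCylDerivAt_contract_paramField i q)).lineDeriv.symm
  have hiter : ∀ K a, pull ((jetAlg hU).iter K a) = (paramAlg hW).iter K (pull a) := by
    intro K a
    induction K using MultiIndex.induction_add_single with
    | zero => simp
    | add K i ih => rw [CommDerivations.iter_add_single, hD, ih, CommDerivations.iter_add_single]
  have hneg : ∀ K a, pull ((jetAlg hU).negIter K a) = (paramAlg hW).negIter K (pull a) := by
    intro K a
    rw [CommDerivations.negIter_apply, CommDerivations.negIter_apply, ← hiter]
    rfl
  -- The velocity of the homotopy has components `w_K = u_K - j_K(x)`, and `w_K = D_K w_0`. Thus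
  -- `∂θ/∂t` is the pulled-back Frechet operator `T` applied to `w_0`.
  set w : MultiIndex n → cylAlg W := fun K => cylAlg.mk _ (hj.isCyl_sub W K) with hw
  have hwD : ∀ K, (paramAlg hW).iter K (w 0) = w K := by
    intro K
    induction K using MultiIndex.induction_add_single with
    | zero => simp
    | add K i ih =>
      rw [CommDerivations.iter_add_single, ih, hw, paramAlg_D_mk, cylAlg.mk_eq_mk]
      intro q hq
      refine HasLineDerivAt.lineDeriv ?_
      have h1 := (IsHolonomic.hasDerivAt_u K q (paramField i q)).fun_sub
        (hj.hasDerivAt_section K i q)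
      simpa [HasLineDerivAt, paramField_apply, totalField_apply] using h1
  have hθ : IsCyl W fun q => f (h q) := hf.comp hc hm
  set a : cylAlg U := cylAlg.mk f hf with ha
  have hfa : Represents f a := represents_mk hf
  set T : MultiIndex n →₀ cylAlg W := ((jetAlg hU).fr a).mapRange pull (map_zero _) with hT
  have hdag : (paramAlg hW).dag T 1 = 0 := by
    have h1 : (jetAlg hU).euler a = 0 := (hfa.eulerLagrange hU).eq_zero_iff.2 hE
    rw [CommDerivations.dag, hT, Finsupp.sum_mapRange_index (by simp)]
    rw [JetDerivations.euler, CommDerivations.dag] at h1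
    have h2 := congrArg pull h1
    rw [Finsupp.sum, map_sum, map_zero] at h2
    rw [Finsupp.sum, ← h2]
    exact Finset.sum_congr rfl fun K _ => by rw [hneg, mul_one, mul_one]
  have happ : (paramAlg hW).app T (w 0) =
      cylAlg.mk (fun q => lineDeriv ℝ (fun q => f (h q)) q (1, 0))
      (hθ.lineDeriv hW (IsCylMap.const W (1, 0))) := by
    ext ⟨q, hq⟩
    rw [CommDerivations.app, hT, Finsupp.sum_mapRange_index (by simp), Finsupp.sum,
      AddSubmonoidClass.coe_finsetSum, Finset.sum_apply, cylAlg.mk_apply,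
      (hf.hasLineDerivAt_comp hU hW hm hq (IsHolonomic.hasCylDerivAt_contract_param j q)).lineDeriv,
      lineDeriv_eq_finsum hU hf (hm hq), finsum_eq_sum_of_support_subset
        (s := ((jetAlg hU).fr a).support)]
    · refine Finset.sum_congr rfl fun K _ => ?_
      rw [hwD, mul_comm, ← (hfa.partialU hU K).apply (hm hq)]
      rfl
    · intro K hK
      by_contra hKs
      rw [Finset.mem_coe, Finsupp.notMem_support_iff, JetDerivations.fr_apply,
        (hfa.partialU hU K).eq_zero_iff] at hKs
      rw [Function.mem_support, hKs _ (hm hq), mul_zero] at hK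
      exact hK rfl
  -- Green's identity against `1`: the term `w_0 T^*(1)` is the pull-back of `E_u(f)` times `w_0`,
  -- hence zero.
  have hdiv := (paramAlg hW).app_mul_sub_mul_dag_mem_divergences T (w 0) 1
  rw [hdag, mul_one, mul_zero, sub_zero, happ] at hdiv
  have hfinal := isTotalDivergence_of_param hV hVU hW hθ hdiv
  have h0 : ∀ p : Jet n, h (0, p) = (p.1, j p.1) := fun p => by
    simp [hh, IsHolonomic.contract]
  have h1 : ∀ p : Jet n, h (1, p) = p := fun p => by
    simp [hh, IsHolonomic.contract]
  simpa only [h0, h1] using hfinal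

/-- The homotopy contracting `x` along the coordinate `x^i` to `x^i = c`, on a section. -/
def contractX (j : (Fin n → ℝ) → MultiIndex n → ℝ) (i : Fin n) (c : ℝ) (q : ℝ × Jet n) : Jet n :=
  (q.2.1 + ((q.1 - 1) * (q.2.1 i - c)) • Pi.single i 1,
    j (q.2.1 + ((q.1 - 1) * (q.2.1 i - c)) • Pi.single i 1))

theorem IsHolonomic.continuous_contractX {j : (Fin n → ℝ) → MultiIndex n → ℝ}
    (hj : IsHolonomic j) (i : Fin n) (c : ℝ) : Continuous (contractX j i c) := by
  have := hj.continuous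
  unfold contractX
  fun_prop

/-- A function that only depends on `x` is locally a total divergence. -/
theorem IsHolonomic.isTotalDivergence_section {j : (Fin n → ℝ) → MultiIndex n → ℝ}
    (hj : IsHolonomic j) (hU : IsOpen U) (hV : IsOpen V) {f : Jet n → ℝ} (hf : IsCyl U f)
    (i : Fin n) (c : ℝ) (hVU : ∀ t ∈ Icc (0 : ℝ) 1, ∀ p ∈ V, contractX j i c (t, p) ∈ U) :
    IsTotalDivergence V fun p => f (p.1, j p.1) := by
  set k := contractX j i c with hk
  set W := k ⁻¹' U with hWdef
  have hW : IsOpen W := hU.preimage (hj.continuous_contractX i c)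
  have hm : MapsTo k W U := fun q hq => hq
  set X : ℝ × Jet n → Fin n → ℝ := fun q => q.2.1 + ((q.1 - 1) * (q.2.1 i - c)) • Pi.single i 1
    with hX
  have hXc : IsCyl W X := by
    refine ((isCyl_param W).prodMk (isCyl_x W)).contDiff_comp
      (φ := fun y : ℝ × (Fin n → ℝ) => y.2 + ((y.1 - 1) * (y.2 i - c)) • Pi.single i (1 : ℝ)) ?_
    fun_prop
  have hkc : IsCylMap W k := isCylMap_jet hXc fun K => hXc.contDiff_comp (hj.contDiff K)
  have hG : IsCyl W fun q => f (k q) := hf.comp hkc hm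
  have hx : IsCyl W fun q => q.2.1 i - c :=
    (isCyl_x W).contDiff_comp (φ := fun y : Fin n → ℝ => y i - c) (by fun_prop)
  have hkd : ∀ (q v : ℝ × Jet n) (r : ℝ),
      HasDerivAt (fun t : ℝ => X (q + t • v)) (r • Pi.single i 1) 0 →
      HasCylDerivAt k (r • totalField i (k q)) q v := by
    intro q v r hr
    refine hasCylDerivAt_jet ?_ fun K => ?_
    · rw [totalField_apply]
      exact hr
    · have h := hj.hasDerivAt_comp hr K
      simp only [zero_smul, add_zero] at h
      rw [totalField_apply]
      exact h
  have hX1 : ∀ q, HasDerivAt (fun t : ℝ => X (q + t • paramField i q))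
      (q.1 • (Pi.single i 1 : Fin n → ℝ)) 0 := by
    intro q
    have h1 := hasDerivAt_add_smul q.2.1 (Pi.single i 1 : Fin n → ℝ)
    have h2 := (((hasDerivAt_add_smul (q.2.1 i) 1).sub_const c).const_mul (q.1 - 1)).smul_const
      (Pi.single i 1 : Fin n → ℝ)
    refine ((h1.fun_add h2).congr_deriv ?_).congr_of_eventuallyEq (Eventually.of_forall fun t => ?_)
    · rw [mul_one, sub_smul, one_smul, add_sub_cancel]
    · simp [hX, paramField_apply, totalField_apply]
  have hX2 : ∀ q : ℝ × Jet n, HasDerivAt (fun t : ℝ => X (q + t • (1, 0)))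
      ((q.2.1 i - c) • (Pi.single i 1 : Fin n → ℝ)) 0 := by
    intro q
    have h2 := ((((hasDerivAt_add_smul q.1 1).sub_const 1).mul_const (q.2.1 i - c)).smul_const
      (Pi.single i 1 : Fin n → ℝ)).const_add q.2.1
    simpa [hX] using h2
  set Z : ℝ × Jet n → ℝ := fun q => lineDeriv ℝ f (k q) (totalField i (k q)) with hZ
  have hG' : ∀ q ∈ W, ∀ v (r : ℝ), HasDerivAt (fun t : ℝ => X (q + t • v)) (r • Pi.single i 1) 0 →
      HasLineDerivAt ℝ (fun q => f (k q)) (r * Z q) q v := by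
    intro q hq v r hr
    have h1 := hf.hasLineDerivAt_comp hU hW hm hq (hkd q v r hr)
    obtain ⟨L, hL⟩ := hf.exists_deriv hU (hm hq)
    have h2 : lineDeriv ℝ f (k q) (r • totalField i (k q)) = r * Z q := by
      have h3 : Z q = L (totalField i (k q)) := (hL _).lineDeriv
      rw [(hL _).lineDeriv, map_smul, h3, smul_eq_mul]
    rwa [h2] at h1
  -- The function `t f(k)` equals `f(x, j(x))` at `t = 1` and `0` at `t = 0`. Its `t`-derivative
  -- `f(k) + t (x^i - c) Z` coincides with `D_i((x^i - c) f(k))`, since `∂_t` moves the base point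
  -- at rate `x^i - c` and `D_i` at rate `t`.
  have hθ : IsCyl W fun q => q.1 * f (k q) := (isCyl_param W).mul hG
  have hΨ : IsCyl W fun q => (q.2.1 i - c) * f (k q) := hx.mul hG
  have hdiv : cylAlg.mk (fun q => lineDeriv ℝ (fun q => q.1 * f (k q)) q (1, 0))
      (hθ.lineDeriv hW (IsCylMap.const W (1, 0))) ∈ (paramAlg hW).divergences := by
    have h1 := (paramAlg hW).D_mem_divergences i (cylAlg.mk _ hΨ)
    convert h1 using 1
    rw [paramAlg_D_mk, cylAlg.mk_eq_mk]
    intro q hq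
    have h2 : HasLineDerivAt ℝ (fun q : ℝ × Jet n => q.1 * f (k q)) _ q (1, 0) :=
      HasDerivAt.fun_mul (c := fun t : ℝ => (q + t • ((1, 0) : ℝ × Jet n)).1)
        (hasDerivAt_add_smul q.1 1) (hG' q hq _ _ (hX2 q))
    have h3 : HasLineDerivAt ℝ (fun q : ℝ × Jet n => (q.2.1 i - c) * f (k q)) _ q
        (paramField i q) :=
      HasDerivAt.fun_mul (c := fun t : ℝ => (q + t • paramField i q).2.1 i - c) (c' := 1)
        (by simpa [paramField_apply, totalField_apply] using
          (hasDerivAt_add_smul (q.2.1 i) 1).sub_const c) (hG' q hq _ _ (hX1 q))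
    rw [h2.lineDeriv, h3.lineDeriv]
    simp
    ring
  have hfinal := isTotalDivergence_of_param hV hVU hW hθ hdiv
  have h1 : ∀ p : Jet n, k (1, p) = (p.1, j p.1) := fun p => by
    simp [hk, contractX]
  simpa only [h1, one_mul, zero_mul, sub_zero] using hfinal

end JetCalculus

end

/-! ### Polynomial sections and local exactness of the Euler operator -/

noncomputable section

namespace JetCalculus

open Set Filter Topology
open scoped ContDiff

variable {n : ℕ} {U V : Set (Jet n)}

/-- The `k`-th derivative of `t ^ m / m!`. -/
def dividedPower (m k : ℕ) (t : ℝ) : ℝ := if k ≤ m then t ^ (m - k) / (m - k).factorial else 0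

theorem dividedPower_zero (m k : ℕ) : dividedPower m k 0 = if k = m then 1 else 0 := by
  unfold dividedPower
  rcases lt_trichotomy k m with h | h | h
  · simp [h.le, h.ne, Nat.sub_ne_zero_of_lt h]
  · simp [h]
  · simp [h.not_ge, h.ne']

theorem hasDerivAt_dividedPower (m k : ℕ) (t : ℝ) :
    HasDerivAt (dividedPower m k) (dividedPower m (k + 1) t) t := by
  unfold dividedPower
  by_cases h : k + 1 ≤ m
  · obtain ⟨l, rfl⟩ := Nat.exists_eq_add_of_le h
    have h1 : k + 1 + l - k = l + 1 := by omega
    have h2 : k + 1 + l - (k + 1) = l := by omega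
    simp only [h, if_true, show k ≤ k + 1 + l by omega, h1, h2]
    refine ((hasDerivAt_pow (l + 1) t).div_const _).congr_deriv ?_
    rw [Nat.factorial_succ]
    push_cast
    field_simp
  · by_cases h' : k ≤ m
    · have : m - k = 0 := by omega
      simpa [h, h', this] using hasDerivAt_const t (1 : ℝ)
    · simpa [h, h'] using hasDerivAt_const t (0 : ℝ)

theorem contDiff_dividedPower (m k : ℕ) : ContDiff ℝ ∞ (dividedPower m k) := by
  unfold dividedPower
  by_cases h : k ≤ m
  · simp only [h, if_true]
    fun_prop
  · simp only [h, if_false]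
    fun_prop

/-- Every finite jet is the jet of a polynomial. -/
theorem exists_isHolonomic (s : Finset (MultiIndex n)) (p : Jet n) :
    ∃ j, IsHolonomic j ∧ ∀ K ∈ s, j p.1 K = p.2 K := by
  -- The Taylor polynomial `∑ p_M (x - x_0)^M / M!` over `M ∈ s`, together with all its derivatives;
  -- at the centre only `M = K` contributes.
  refine ⟨fun x K => ∑ M ∈ s, p.2 M * ∏ i, dividedPower (M i) (K i) (x i - p.1 i),
    ⟨fun K => ?_, fun K i x => ?_⟩, fun K hK => ?_⟩
  · have := contDiff_dividedPower
    refine ContDiff.sum fun M _ => contDiff_const.mul (contDiff_prod fun i _ => ?_)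
    exact (this _ _).comp (by fun_prop)
  · have hdiff : DifferentiableAt ℝ (fun x : Fin n → ℝ => ∑ M ∈ s, p.2 M *
        ∏ i, dividedPower (M i) (K i) (x i - p.1 i)) x := by
      have := contDiff_dividedPower
      refine ContDiff.differentiable (n := ∞) (ContDiff.sum fun M _ => contDiff_const.mul
        (contDiff_prod fun i _ => ?_)) (by simp) x
      exact (this _ _).comp (by fun_prop)
    rw [← hdiff.lineDeriv_eq_fderiv]
    refine HasLineDerivAt.lineDeriv ?_
    refine HasDerivAt.fun_sum fun M _ => HasDerivAt.const_mul _ ?_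
    have hsplit : ∀ (L : MultiIndex n) (y : Fin n → ℝ),
        ∏ l, dividedPower (M l) (L l) (y l - p.1 l) = dividedPower (M i) (L i) (y i - p.1 i) *
          ∏ l ∈ Finset.univ.erase i, dividedPower (M l) (L l) (y l - p.1 l) :=
      fun L y => (Finset.mul_prod_erase _ _ (Finset.mem_univ i)).symm
    have h1 : HasDerivAt (fun t : ℝ => dividedPower (M i) (K i) (x i + t - p.1 i))
        (dividedPower (M i) (K i + 1) (x i - p.1 i)) 0 := by
      have h2 : HasDerivAt (dividedPower (M i) (K i)) (dividedPower (M i) (K i + 1) (x i - p.1 i))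
          (x i + 0 - p.1 i) := by simpa using hasDerivAt_dividedPower (M i) (K i) (x i - p.1 i)
      have h3 : HasDerivAt (fun t : ℝ => x i + t - p.1 i) 1 0 :=
        ((hasDerivAt_id (0 : ℝ)).const_add (x i)).sub_const (p.1 i)
      simpa [Function.comp_def] using h2.comp 0 h3
    refine ((h1.mul_const (∏ l ∈ Finset.univ.erase i,
      dividedPower (M l) (K l) (x l - p.1 l))).congr_deriv ?_).congr_of_eventuallyEq
        (Eventually.of_forall fun t => ?_)
    · rw [hsplit]
      congr 1
      · simp
      · refine Finset.prod_congr rfl fun l hl => ?_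
        simp [Finset.ne_of_mem_erase hl]
    · simp only [hsplit]
      congr 1
      · simp
      · refine Finset.prod_congr rfl fun l hl => ?_
        simp [Finset.ne_of_mem_erase hl]
  · simp only [sub_self]
    rw [Finset.sum_eq_single K]
    · simp [dividedPower_zero]
    · intro M _ hMK
      obtain ⟨i, hi⟩ : ∃ i, M i ≠ K i := by
        by_contra! h
        exact hMK (funext h)
      rw [Finset.prod_eq_zero (Finset.mem_univ i), mul_zero]
      simp [dividedPower_zero, Ne.symm hi]
    · exact fun h => absurd hK h

theorem isHolonomic_zero : IsHolonomic (fun (_ : Fin n → ℝ) (_ : MultiIndex n) => (0 : ℝ)) :=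
  ⟨fun _ => contDiff_const, fun _ _ _ => by simp⟩

/-- Basic neighbourhoods of the product topology restrict finitely many coordinates, so jet domains
form a neighbourhood basis. -/
theorem exists_isJetDomain_subset {p : Jet n} {N : Set (Jet n)} (hN : N ∈ 𝓝 p) :
    ∃ V, IsJetDomain V ∧ p ∈ V ∧ V ⊆ N := by
  obtain ⟨u, hu, v, hv, huv⟩ := mem_nhds_prod_iff.1 hN
  rw [nhds_pi, Filter.mem_pi'] at hv
  obtain ⟨s, t, ht, hs⟩ := hv
  refine ⟨proj s ⁻¹' (interior u ×ˢ Set.pi univ fun K : s => interior (t K)),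
    ⟨s, _, isOpen_interior.prod (isOpen_set_pi finite_univ fun K _ => isOpen_interior), rfl⟩,
    ⟨mem_interior_iff_mem_nhds.2 hu, fun K _ => mem_interior_iff_mem_nhds.2 (ht K)⟩, ?_⟩
  rintro q ⟨hq1, hq2⟩
  exact huv ⟨interior_subset hq1, hs fun K hK => interior_subset (hq2 ⟨K, hK⟩ (mem_univ _))⟩

theorem IsTotalDivergence.add (hV : IsOpen V) {f g : Jet n → ℝ} (hf : IsTotalDivergence V f)
    (hg : IsTotalDivergence V g) (hfc : IsCyl V f) (hgc : IsCyl V g) :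
    IsTotalDivergence V fun p => f p + g p := by
  have h1 := (represents_mk hfc).isTotalDivergence_iff hV
  have h2 := (represents_mk hgc).isTotalDivergence_iff hV
  have h3 := ((represents_mk hfc).add (represents_mk hgc)).isTotalDivergence_iff hV
  exact h3.2 (Submodule.add_mem _ (h1.1 hf) (h2.1 hg))

/-- A differential function with vanishing variational derivative is a total divergence on any
domain that contracts, inside the domain of the function, to a holonomic section and along it. -/
theorem IsHolonomic.isTotalDivergence {j : (Fin n → ℝ) → MultiIndex n → ℝ}
    (hj : IsHolonomic j) (hU : IsOpen U) (hV : IsOpen V) {f : Jet n → ℝ} (hf : IsCyl U f)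
    (hE : ∀ p ∈ U, eulerLagrange f p = 0) (i : Fin n) (c : ℝ)
    (h1 : ∀ t ∈ Icc (0 : ℝ) 1, ∀ p ∈ V, IsHolonomic.contract j (t, p) ∈ U)
    (h2 : ∀ t ∈ Icc (0 : ℝ) 1, ∀ p ∈ V, contractX j i c (t, p) ∈ U) :
    IsTotalDivergence V f := by
  have hVU : V ⊆ U := fun p hp => by
    simpa [IsHolonomic.contract] using h1 1 (by simp) p hp
  have hfst : IsCyl V fun p : Jet n => p.1 :=
    IsCyl.clm V (ContinuousLinearMap.fst ℝ (Fin n → ℝ) (MultiIndex n → ℝ))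
  have hg : IsCyl V fun p => f (p.1, j p.1) :=
    hf.comp (isCylMap_jet hfst fun K => hfst.contDiff_comp (hj.contDiff K)) fun p hp => by
      simpa [contractX] using h2 1 (by simp) p hp
  have hfg : IsCyl V fun p => f p - f (p.1, j p.1) :=
    ((hf.mono hVU).prodMk hg).contDiff_comp (φ := fun y : ℝ × ℝ => y.1 - y.2) (by fun_prop)
  simpa using (hj.isTotalDivergence_sub hU hV hf hE h1).add hV
    (hj.isTotalDivergence_section hU hV hf i c h2) hfg hg

/-- The polynomial section agrees with `p` in the finitely many coordinates that define `U`, and `c`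
is the coordinate `x^i` of `p`. Both homotopies therefore fix these coordinates of `p` and stay in
`U`; by compactness of `[0, 1]` the same holds for all jets near `p`. -/
theorem exists_isTotalDivergence_of_eulerLagrange_eq_zero (hn : 1 ≤ n) (hU : IsJetDomain U)
    {f : Jet n → ℝ} (hf : IsCyl U f) (hE : ∀ p ∈ U, eulerLagrange f p = 0) {p : Jet n}
    (hp : p ∈ U) : ∃ V, IsJetDomain V ∧ p ∈ V ∧ V ⊆ U ∧ IsTotalDivergence V f := by
  have hUo := hU.isOpen
  obtain ⟨s, U', hU', hUeq⟩ := id hU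
  obtain ⟨j, hj, hjs⟩ := exists_isHolonomic s p
  set i : Fin n := ⟨0, hn⟩
  have hmem : ∀ q : Jet n, q.1 = p.1 → (∀ K ∈ s, q.2 K = p.2 K) → q ∈ U := by
    intro q h1 h2
    rw [hUeq, mem_preimage] at hp ⊢
    have : proj s q = proj s p := Prod.ext h1 (funext fun K => h2 K K.2)
    rwa [this]
  have key : ∀ h : ℝ × Jet n → Jet n, Continuous h → (∀ t, h (t, p) ∈ U) →
      ∀ᶠ q in 𝓝 p, ∀ t ∈ Icc (0 : ℝ) 1, h (t, q) ∈ U := by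
    intro h hc hmem
    refine isCompact_Icc.eventually_forall_of_forall_eventually fun t _ => ?_
    have : Continuous fun z : Jet n × ℝ => h (z.2, z.1) := by fun_prop
    exact this.continuousAt.preimage_mem_nhds (hUo.mem_nhds (hmem t))
  have e1 := key _ hj.continuous_contract fun t =>
    hmem _ rfl fun K hK => by simp [IsHolonomic.contract, hjs K hK]
  have e2 := key _ (hj.continuous_contractX i (p.1 i)) fun t =>
    hmem _ (by simp [contractX]) fun K hK => by simp [contractX, hjs K hK]
  obtain ⟨V, hV, hpV, hVsub⟩ := exists_isJetDomain_subset
    (Filter.inter_mem (hUo.mem_nhds hp) (Filter.inter_mem e1 e2))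
  exact ⟨V, hV, hpV, fun q hq => (hVsub hq).1, hj.isTotalDivergence hUo hV.isOpen hf hE i (p.1 i)
    (fun t ht q hq => (hVsub hq).2.1 t ht) fun t ht q hq => (hVsub hq).2.2 t ht⟩

/-- On the whole jet space no homotopy can leave the domain, so contraction to the zero section
gives a global current. -/
theorem isTotalDivergence_univ_of_eulerLagrange_eq_zero (hn : 1 ≤ n) {f : Jet n → ℝ}
    (hf : IsCyl univ f) (hE : ∀ p, eulerLagrange f p = 0) : IsTotalDivergence univ f :=
  isHolonomic_zero.isTotalDivergence isOpen_univ isOpen_univ hf (fun p _ => hE p) ⟨0, hn⟩ 0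
    (fun _ _ _ _ => mem_univ _) fun _ _ _ _ => mem_univ _

theorem IsTotalDivergence.eulerLagrange_eq_zero (hV : IsOpen V) {f : Jet n → ℝ}
    (hf : IsTotalDivergence V f) (hfc : IsCyl V f) {p : Jet n} (hp : p ∈ V) :
    eulerLagrange f p = 0 := by
  have h := represents_mk hfc
  exact (h.eulerLagrange hV).eq_zero_iff.1 ((jetAlg hV).euler_eq_zero_of_mem_divergences
    ((h.isTotalDivergence_iff hV).1 hf)) p hp

/-- Evaluation at a solution jet is a ring homomorphism that kills the generators `D_K G`. -/
theorem Represents.eq_zero_of_mem_diffIdeal (hU : IsOpen U) {G f : Jet n → ℝ} {g a : cylAlg U}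
    (hG : Represents G g) (hf : Represents f a) (h : a ∈ (jetAlg hU).diffIdeal g) {p : Jet n}
    (hp : p ∈ solutionSpace U G) : f p = 0 := by
  have key : ∀ b ∈ (jetAlg hU).diffIdeal g, (b : U → ℝ) ⟨p, hp.1⟩ = 0 := by
    intro b hb
    refine Submodule.span_induction ?_ rfl ?_ ?_ hb
    · rintro _ ⟨K, rfl⟩
      rw [(hG.totalDerivs hU K).apply hp.1, hp.2]
    · intro b c _ _ hb hc
      simp [hb, hc]
    · intro b c _ hc
      simp [hc]
  rw [← hf.apply hp.1, key a h]

end JetCalculus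

end

/-! ### The proposition -/

theorem proposition4p2 (n : ℕ) (hn : 1 ≤ n)
    (U : Set (JetCalculus.Jet n)) (hU : JetCalculus.IsJetDomain U)
    (G P Q : JetCalculus.Jet n → ℝ) (RP RQ : JetCalculus.DiffOp n)
    (hG : JetCalculus.IsDiffFun U G)
    (hP : JetCalculus.IsSymmetry U G P)
    (hRP : JetCalculus.IsDiffOp U RP)
    (hGP : ∀ p ∈ U, (JetCalculus.frechet G).apply P p = RP.apply G p)
    (hQ : JetCalculus.IsAdjointSymmetry U G Q)
    (hRQ : JetCalculus.IsDiffOp U RQ)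
    (hGQ : ∀ p ∈ U, (JetCalculus.frechet G).adjoint.apply Q p = RQ.apply G p) :
    -- `S(P)` is an adjoint-symmetry
    JetCalculus.IsAdjointSymmetry U G ((JetCalculus.opS Q RQ).apply P) ∧
    -- it is a multiplier of a conservation law iff the condition holds
    (JetCalculus.IsMultiplier U G ((JetCalculus.opS Q RQ).apply P) ↔
      JetCalculus.MultiplierCondition U G P (JetCalculus.opS Q RQ) RP) ∧
    -- the same for the determining equation `E_u(S(P) G) = 0` of multipliers
    ((∀ p ∈ U, JetCalculus.eulerLagrange
        (fun q => (JetCalculus.opS Q RQ).apply P q * G q) p = 0) ↔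
      JetCalculus.MultiplierCondition U G P (JetCalculus.opS Q RQ) RP) ∧
    -- and, on the whole jet space, for the existence of a globally defined conserved current
    (U = Set.univ →
      (JetCalculus.IsTotalDivergence U
          (fun q => (JetCalculus.opS Q RQ).apply P q * G q) ↔
        JetCalculus.MultiplierCondition U G P (JetCalculus.opS Q RQ) RP)) := by
  have hUo := hU.isOpen
  obtain ⟨g, hg⟩ := hG.exists_represents hUo
  obtain ⟨a, ha⟩ := hP.1.exists_represents hUo
  obtain ⟨b, hb⟩ := hQ.1.exists_represents hUo
  obtain ⟨Ra, hRa⟩ := hRP.exists_represents hUo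
  obtain ⟨Rb, hRb⟩ := hRQ.exists_represents hUo
  have hp := (((hg.frechet hUo).apply hUo ha).eq_iff (hRa.apply hUo hg)).2 hGP
  have hq := ((((hg.frechet hUo).adjoint hUo).apply hUo hb).eq_iff (hRb.apply hUo hg)).2 hGQ
  have hS : JetCalculus.RepresentsOp (JetCalculus.opS Q RQ) _ :=
    (hRb.adjoint hUo).add (hb.frechet hUo)
  have hSP := hS.apply hUo ha
  have hSPG := hSP.mul hg
  have hS' := hS.adjoint hUo
  have hcond := ((((JetCalculus.RepresentsOp.prolongOp hUo ha hS').apply hUo hg).add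
    (hS'.apply hUo (hRa.apply hUo hg))).add
      (((ha.frechet hUo).adjoint hUo).apply hUo (hS'.apply hUo hg)))
  -- The ring identity, read back on `U`: the variational derivative of `S(P) G` is the left side of
  -- the condition.
  have hmain := ((hSPG.eulerLagrange hUo).eq_iff hcond).1
    ((JetCalculus.jetAlg hUo).euler_app_mul hp hq)
  have hE : (∀ p ∈ U, JetCalculus.eulerLagrange
      (fun q => (JetCalculus.opS Q RQ).apply P q * G q) p = 0) ↔
      JetCalculus.MultiplierCondition U G P (JetCalculus.opS Q RQ) RP :=
    forall₂_congr fun p hp => by rw [hmain p hp]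
  refine ⟨⟨hSP.isDiffFun, fun p hp' => ?_⟩, ?_, hE, ?_⟩
  · exact hg.eq_zero_of_mem_diffIdeal hUo (((hg.frechet hUo).adjoint hUo).apply hUo hSP)
      ((JetCalculus.jetAlg hUo).app_adj_fr_mem_diffIdeal hp hq) hp'
  · rw [← hE]
    constructor
    -- The variational derivative at a point only depends on the function nearby, so local currents
    -- suffice.
    · rintro ⟨-, h⟩ p hpU
      obtain ⟨V, hV, hpV, hVU, hdiv⟩ := h p hpU
      exact hdiv.eulerLagrange_eq_zero hV.isOpen (hSPG.isCyl.mono hVU) hpV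
    · exact fun h => ⟨hSP.isDiffFun, fun p hpU =>
        JetCalculus.exists_isTotalDivergence_of_eulerLagrange_eq_zero hn hU hSPG.isCyl h hpU⟩
  · rintro rfl
    rw [← hE]
    exact ⟨fun h p hpU => h.eulerLagrange_eq_zero hUo hSPG.isCyl hpU, fun h =>
      JetCalculus.isTotalDivergence_univ_of_eulerLagrange_eq_zero hn hSPG.isCyl
        fun p => h p (Set.mem_univ p)⟩
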